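/- **Setting.** Let $(X,Y)$ have distribution $P$ on $\mathcal X\times\mathcal Y$, let $\mu$ be the law of $X$, and write $\|\cdot\|_{L_2}$ for the norm of $L_2(\mu)$. Let $E$ be a linear space of measurable functions $\mathcal X\to\mathbb R$ contained in $L_2(\mu)$, and let $F\subset E$ be convex. Let $\bar\ell$ be a loss, $\ell_f(x,y)=\bar\ell(f(x),y)$, such that for some $L>0$, for all $f,g\in F$, all $(x,y)$ and all $\alpha\in[0,1]$, $$|\bar\ell(f(x),y)-\bar\ell(g(x),y)|\le L|f(x)-g(x)|,\qquad \bar\ell(\alpha f(x)+(1-\alpha)g(x),y)\le\alpha\bar\ell(f(x),y)+(1-\alpha)\bar\ell(g(x),y).$$ Let $f^*\in F$ minimize the risk over $F$, i.e. $P\mathcal L_f:=\mathbb E_P[\ell_f(X,Y)-\ell_{f^*}(X,Y)]\ge 0$ for all $f\in F$. Let $\phi:E\to[0,\infty)$ be even and convex with $\phi(0)=0$, and let $\eta>0$ satisfy $\phi(f+g)\le\eta(\phi(f)+\phi(g))$ for all $f,g\in F$. **Data.** Let $(X_i,Y_i)_{i=1}^N$ be the data ($N\ge1$) and $\{1,\dots,N\}=\mathcal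 I\cup\mathcal O$ an unknown partition. The pairs $(X_i,Y_i)_{i\in\mathcal I}$ are independent and, for all $i\in\mathcal I$ and $f\in F$, $\mathbb E(f-f^*)^2(X_i)=\|f-f^*\|_{L_2}^2$ and $\mathbb E[\ell_f(X_i,Y_i)-\ell_{f^*}(X_i,Y_i)]=P\mathcal L_f$. Nothing is assumed on $(X_i,Y_i)_{i\in\mathcal O}$. Let $B_1,\dots,B_S$ be a partition of $\{1,\dots,N\}$ into blocks of equal size $N/S$ (with $S$ dividing $N$), and put $$\mathrm{MOM}_S(\ell_f-\ell_g)=\mathrm{Med}_{1\le s\le S}\Big(\tfrac1{|B_s|}\sum_{i\in B_s}(\ell_f-\ell_g)(X_i,Y_i)\Big),$$ $$\hat f_S^\lambda\in\operatorname*{argmin}_{f\in F}\ \sup_{g\in F}\ \Big\{\mathrm{MOM}_S(\ell_f-\ell_g)+\lambda(\phi(f)-\phi(g))\Big\}.$$ **Complexity.** For $A>0$ and $r>0$ let $F_{A,r}=\{f\in F:\|f-f^*\|_{L_2}\le r,\ \phi(f-f^*)\le\eta(4+2/A)\phi(f^*)\}$; with i.i.d. Rademacher variables $\sigma_i$ independent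 of the informative data, let $$\tilde r(A)=\inf\Big\{r>0:\ \forall J\subset\mathcal I \text{ with } |J|\ge N/2,\ \ \mathbb E\sup_{f\in F_{A,r}}\Big|\sum_{i\in J}\sigma_i(f-f^*)(X_i)\Big|\le\frac{r^2|J|}{384AL}\Big\}$$ ($\inf\emptyset=\infty$), and $$C_{S,r}(A)=\max\Big(\tilde r(A)^2,\ 368A^2L^2\frac SN\Big).$$ Fix $\tilde A>0$ such that the local Bernstein condition holds: for every $f\in F$ with $\|f-f^*\|_{L_2}=\sqrt{C_{S,r}(\tilde A)}$ and $\phi(f-f^*)\le\eta(4+2/\tilde A)\phi(f^*)$, one has $\|f-f^*\|_{L_2}^2\le\tilde A\,P\mathcal L_f$. Assume (so that the suprema are measurable) that for every $r>0$ the class $F_{\tilde A,r}$ has a countable subset such that every element of $F_{\tilde A,r}$ is the pointwise limit of a sequence in that subset. **Theorem.** Let $S\ge 7|\mathcal O|/3$. Then, with probability at least $1-2\exp(-S/504)$, simultaneously for all $\lambda>C_{S,r}(\tilde A)/\phi(f^*)$ (no $\lambda$ if $\phi(f^*)=0$ or $C_{S,r}(\tilde A)=\infty$), every estimator $\hat f_S^\lambda$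 satisfies $$\phi(\hat f_S^\lambda-f^*)\le\eta(4+2/\tilde A)\,\phi(f^*),\qquad \|\hat f_S^\lambda-f^*\|_{L_2}\le(4+6\tilde A)\,\lambda\,\frac{\phi(f^*)}{\sqrt{C_{S,r}(\tilde A)}}.$$ -/

import Mathlib

open MeasureTheory ProbabilityTheory Filter Topology
open scoped ENNReal

noncomputable section

namespace MinmaxMOM

/-- `E` is a linear space of (genuine, everywhere defined) measurable functions that are square
integrable with respect to `μ`. -/
def IsL2Space {𝒳 : Type*} [MeasurableSpace 𝒳] (μ : Measure 𝒳) (E : Submodule ℝ (𝒳 → ℝ)) : Prop :=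
  ∀ f ∈ E, Measurable f ∧ MemLp f 2 μ

/-- The loss `ℓ_f(x, y) = ℓ(f(x), y)` is `L`-Lipschitz and convex in the prediction, on the values
taken by the functions of `F`. -/
structure IsLipschitzConvexLoss {𝒳 𝒴 : Type*} (F : Set (𝒳 → ℝ)) (ℓ : ℝ → 𝒴 → ℝ) (L : ℝ) :
    Prop where
  pos : 0 < L
  lipschitz : ∀ f ∈ F, ∀ g ∈ F, ∀ (x : 𝒳) (y : 𝒴), |ℓ (f x) y - ℓ (g x) y| ≤ L * |f x - g x|
  convex : ∀ α : ℝ, 0 ≤ α → α ≤ 1 → ∀ f ∈ F, ∀ g ∈ F, ∀ (x : 𝒳) (y : 𝒴),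
    ℓ (α * f x + (1 - α) * g x) y ≤ α * ℓ (f x) y + (1 - α) * ℓ (g x) y

/-- The excess risk `P 𝓛_f = E[ℓ(f(X), Y) - ℓ(f*(X), Y)]`, `(X, Y) ∼ P`. -/
def excessRisk {𝒳 𝒴 : Type*} [MeasurableSpace 𝒳] [MeasurableSpace 𝒴] (P : Measure (𝒳 × 𝒴))
    (ℓ : ℝ → 𝒴 → ℝ) (fstar f : 𝒳 → ℝ) : ℝ :=
  ∫ z, (ℓ (f z.1) z.2 - ℓ (fstar z.1) z.2) ∂P

/-- `fstar` minimizes the risk over `F`. The comparison of risks is made through the excess risk,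
which is finite for Lipschitz losses even if the risks themselves are not. -/
def IsOracle {𝒳 𝒴 : Type*} [MeasurableSpace 𝒳] [MeasurableSpace 𝒴] (P : Measure (𝒳 × 𝒴))
    (ℓ : ℝ → 𝒴 → ℝ) (F : Set (𝒳 → ℝ)) (fstar : 𝒳 → ℝ) : Prop :=
  fstar ∈ F ∧ ∀ f ∈ F, 0 ≤ excessRisk P ℓ fstar f

/-- The regularization function: nonnegative, even and convex on `E`, zero at zero, and
quasi-subadditive on `F` with constant `η`. Only the values of `φ` on `E` matter. -/
structure IsRegularizer {𝒳 : Type*} (E : Submodule ℝ (𝒳 → ℝ)) (F : Set (𝒳 → ℝ))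
    (φ : (𝒳 → ℝ) → ℝ) (η : ℝ) : Prop where
  nonneg : ∀ f ∈ E, 0 ≤ φ f
  even : ∀ f ∈ E, φ (-f) = φ f
  convex : ConvexOn ℝ (E : Set (𝒳 → ℝ)) φ
  zero : φ 0 = 0
  eta_pos : 0 < η
  quasi_add : ∀ f ∈ F, ∀ g ∈ F, φ (f + g) ≤ η * (φ f + φ g)

/-- The informative data `(X_i, Y_i)`, `i ∈ I`, are independent random variables which induce the
same `L₂` structure on `F - f*` and the same excess risk as `P`. Nothing is required for
`i ∉ I`. -/
structure IsInformative {Ω 𝒳 𝒴 : Type*} [MeasurableSpace Ω] [MeasurableSpace 𝒳]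
    [MeasurableSpace 𝒴] {N : ℕ} (Pr : Measure Ω) (P : Measure (𝒳 × 𝒴)) (ℓ : ℝ → 𝒴 → ℝ)
    (F : Set (𝒳 → ℝ)) (fstar : 𝒳 → ℝ) (X : Fin N → Ω → 𝒳) (Y : Fin N → Ω → 𝒴)
    (I : Finset (Fin N)) : Prop where
  measurable_X : ∀ i ∈ I, Measurable (X i)
  measurable_Y : ∀ i ∈ I, Measurable (Y i)
  indep : iIndepFun (fun (i : I) (ω : Ω) => (X i ω, Y i ω)) Pr
  same_L2 : ∀ i ∈ I, ∀ f ∈ F,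
    eLpNorm (fun ω => f (X i ω) - fstar (X i ω)) 2 Pr = eLpNorm (f - fstar) 2 (P.map Prod.fst)
  same_excessRisk : ∀ i ∈ I, ∀ f ∈ F,
    excessRisk (Pr.map fun ω => (X i ω, Y i ω)) ℓ fstar f = excessRisk P ℓ fstar f

/-- The localized class `{f ∈ F : ‖f - f*‖_{L₂(μ)} ≤ r, φ(f - f*) ≤ ρ}`. -/
def localClass {𝒳 : Type*} [MeasurableSpace 𝒳] (μ : Measure 𝒳) (F : Set (𝒳 → ℝ))
    (φ : (𝒳 → ℝ) → ℝ) (fstar : 𝒳 → ℝ) (ρ r : ℝ) : Set (𝒳 → ℝ) :=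
  {f | f ∈ F ∧ eLpNorm (f - fstar) 2 μ ≤ ENNReal.ofReal r ∧ φ (f - fstar) ≤ ρ}

/-- A class `G` of functions is pointwise measurable (pointwise separable) if it has a countable
subclass `T` such that each `g ∈ G` is the pointwise limit of a sequence in `T`. This is the usual
condition under which suprema over `G` are measurable. -/
def IsPointwiseMeasurable {𝒳 : Type*} (G : Set (𝒳 → ℝ)) : Prop :=
  ∃ T : Set (𝒳 → ℝ), T ⊆ G ∧ T.Countable ∧
    ∀ g ∈ G, ∃ u : ℕ → 𝒳 → ℝ, (∀ n, u n ∈ T) ∧ ∀ x, Tendsto (fun n => u n x) atTop (𝓝 (g x))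

/-- The Rademacher distribution: `±1` with probability `1/2` each. -/
def rademacher : Measure ℝ :=
  (2⁻¹ : ℝ≥0∞) • (Measure.dirac 1 + Measure.dirac (-1))

/-- `E sup_{f ∈ G} |∑_{i ∈ J} σ_i (f - f*)(X_i)|`, where `σ_1, …, σ_N` are i.i.d. Rademacher
variables independent of the data. -/
def rademacherComplexity {Ω 𝒳 : Type*} [MeasurableSpace Ω] {N : ℕ} (Pr : Measure Ω)
    (X : Fin N → Ω → 𝒳) (fstar : 𝒳 → ℝ) (G : Set (𝒳 → ℝ)) (J : Finset (Fin N)) : ℝ≥0∞ :=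
  ∫⁻ p : Ω × (Fin N → ℝ),
    (⨆ f ∈ G, ENNReal.ofReal |∑ i ∈ J, p.2 i * (f (X i p.1) - fstar (X i p.1))|)
    ∂(Pr.prod (Measure.pi fun _ : Fin N => rademacher))

/-- The radius `η (4 + 2 / A) φ(f*)` of the localization in `φ`. -/
def rhoStar {𝒳 : Type*} (φ : (𝒳 → ℝ) → ℝ) (fstar : 𝒳 → ℝ) (η A : ℝ) : ℝ :=
  η * (4 + 2 / A) * φ fstar

/-- The complexity fixed point `r̃(A)`, with the value `∞` if no radius is admissible. -/
def rTilde {Ω 𝒳 : Type*} [MeasurableSpace Ω] [MeasurableSpace 𝒳] {N : ℕ} (Pr : Measure Ω)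
    (μ : Measure 𝒳) (F : Set (𝒳 → ℝ)) (φ : (𝒳 → ℝ) → ℝ) (fstar : 𝒳 → ℝ) (X : Fin N → Ω → 𝒳)
    (I : Finset (Fin N)) (η L A : ℝ) : ℝ≥0∞ :=
  sInf (ENNReal.ofReal '' {r : ℝ | 0 < r ∧ ∀ J ⊆ I, (N : ℝ) / 2 ≤ (J.card : ℝ) →
    rademacherComplexity Pr X fstar (localClass μ F φ fstar (rhoStar φ fstar η A) r) J
      ≤ ENNReal.ofReal ((384 * A * L)⁻¹ * r ^ 2 * J.card)})

/-- `C_{S,r}(A) = max (r̃(A)², 368 A² L² S / N)`. -/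
def CSr {Ω 𝒳 : Type*} [MeasurableSpace Ω] [MeasurableSpace 𝒳] {N : ℕ} (Pr : Measure Ω)
    (μ : Measure 𝒳) (F : Set (𝒳 → ℝ)) (φ : (𝒳 → ℝ) → ℝ) (fstar : 𝒳 → ℝ) (X : Fin N → Ω → 𝒳)
    (I : Finset (Fin N)) (S : ℕ) (η L A : ℝ) : ℝ≥0∞ :=
  max (rTilde Pr μ F φ fstar X I η L A ^ 2)
    (ENNReal.ofReal (368 * A ^ 2 * L ^ 2 * ((S : ℝ) / (N : ℝ))))

/-- The local Bernstein condition with constant `A` at the squared `L₂`-radius `C` and the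
`φ`-radius `ρ`. -/
def LocalBernstein {𝒳 𝒴 : Type*} [MeasurableSpace 𝒳] [MeasurableSpace 𝒴] (P : Measure (𝒳 × 𝒴))
    (ℓ : ℝ → 𝒴 → ℝ) (F : Set (𝒳 → ℝ)) (φ : (𝒳 → ℝ) → ℝ) (fstar : 𝒳 → ℝ) (C : ℝ≥0∞)
    (ρ A : ℝ) : Prop :=
  ∀ f ∈ F, eLpNorm (f - fstar) 2 (P.map Prod.fst) = C ^ (1 / 2 : ℝ) → φ (f - fstar) ≤ ρ →
    (eLpNorm (f - fstar) 2 (P.map Prod.fst)).toReal ^ 2 ≤ A * excessRisk P ℓ fstar f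

/-- `B_1, …, B_S` is a partition of the `N` indices into blocks of equal size `N / S`. -/
structure IsBlockPartition {N S : ℕ} (B : Fin S → Finset (Fin N)) : Prop where
  disjoint : Pairwise fun s t => Disjoint (B s) (B t)
  cover : ∀ i, ∃ s, i ∈ B s
  card_eq : ∀ s, (B s).card * S = N

/-- The median of `S` real numbers: the mean of the order statistics of (zero-based) ranks
`⌊(S - 1) / 2⌋` and `⌊S / 2⌋`, that is, the middle one if `S` is odd and the mean of the two middle
ones if `S` is even. -/
def median {S : ℕ} (x : Fin S → ℝ) : ℝ :=
  if h : 0 < S then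
    (x (Tuple.sort x ⟨(S - 1) / 2, by omega⟩) + x (Tuple.sort x ⟨S / 2, by omega⟩)) / 2
  else 0

/-- `MOM_S(ℓ_f - ℓ_g)` for the sample `(x_i, y_i)` and the blocks `B`. -/
def MOM {𝒳 𝒴 : Type*} {N S : ℕ} (B : Fin S → Finset (Fin N)) (ℓ : ℝ → 𝒴 → ℝ) (x : Fin N → 𝒳)
    (y : Fin N → 𝒴) (f g : 𝒳 → ℝ) : ℝ :=
  median fun s : Fin S =>
    (1 / ((B s).card : ℝ)) * ∑ i ∈ B s, (ℓ (f (x i)) (y i) - ℓ (g (x i)) (y i))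

/-- `sup_{g ∈ F} MOM_S(ℓ_f - ℓ_g) + lam (φ(f) - φ(g))`, which may be infinite. -/
def minmaxObjective {𝒳 𝒴 : Type*} {N S : ℕ} (B : Fin S → Finset (Fin N)) (ℓ : ℝ → 𝒴 → ℝ)
    (F : Set (𝒳 → ℝ)) (φ : (𝒳 → ℝ) → ℝ) (lam : ℝ) (x : Fin N → 𝒳) (y : Fin N → 𝒴)
    (f : 𝒳 → ℝ) : EReal :=
  ⨆ g ∈ F, ((MOM B ℓ x y f g + lam * (φ f - φ g) : ℝ) : EReal)

/-- `fhat` is a regularized minmax MOM estimator: it minimizes the minmax objective over `F`. -/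
def IsMinmaxMOM {𝒳 𝒴 : Type*} {N S : ℕ} (B : Fin S → Finset (Fin N)) (ℓ : ℝ → 𝒴 → ℝ)
    (F : Set (𝒳 → ℝ)) (φ : (𝒳 → ℝ) → ℝ) (lam : ℝ) (x : Fin N → 𝒳) (y : Fin N → 𝒴)
    (fhat : 𝒳 → ℝ) : Prop :=
  fhat ∈ F ∧ ∀ f ∈ F, minmaxObjective B ℓ F φ lam x y fhat ≤ minmaxObjective B ℓ F φ lam x y f

end MinmaxMOM

end

/-!
Call `f` well estimated by a sample if more than half of the block means of `ℓ_f - ℓ_{f*}` are at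
least `P 𝓛_f - τ`, where `τ = 2 r² / (3 A)` and `r² = C_{S,r}(A)`.

*Deterministic part.* If all `f` in the localized class `F_{A,r}` are well estimated, then by
convexity of the loss the estimates on the boundary of `F_{A,r}` extend along rays from `f*`. Far
from `f*`, either the Bernstein condition (on the `L₂`-boundary) or the regularization term (on the
`φ`-boundary) makes the objective too large at `f̂`, whose objective is at most that of `f*`.

*Probabilistic part.* At least `4 S / 7` of the blocks consist of informative data. The number of
those whose mean deviates by more than `τ` is at most a sum of independent `[0, 1]`-valued ramp
functions of the deviations. Its expectation is small by Chebyshev's inequality, and its supremum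
over the class is controlled by McDiarmid's inequality, symmetrization and the contraction
principle. All this is done for finite families, and reaches `F_{A,r}` through a countable
pointwise dense subset.
-/

noncomputable section

namespace MinmaxMOM

section FiniteSuprema

variable {T : Type*} [Finite T] [Nonempty T]

lemma lipschitzWith_iSup [Fintype T] : LipschitzWith 1 fun v : T → ℝ => ⨆ t, v t := by
  refine LipschitzWith.of_le_add fun v w => ciSup_le fun t => ?_
  have hvw : v t - w t ≤ dist v w :=
    (le_abs_self _).trans ((Real.dist_eq _ _).symm.trans_le (dist_le_pi_dist v w t))
  linarith [Finite.le_ciSup w t]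

lemma iSup_add_add_iSup_sub_le {c a b : T → ℝ} (h : ∀ s t, |b s - b t| ≤ |a s - a t|) :
    (⨆ t, (c t + b t)) + ⨆ t, (c t - b t) ≤ (⨆ t, (c t + a t)) + ⨆ t, (c t - a t) := by
  obtain ⟨s, hs⟩ := exists_eq_ciSup_of_finite (f := fun t => c t + b t)
  obtain ⟨t, ht⟩ := exists_eq_ciSup_of_finite (f := fun t => c t - b t)
  have hb : b s - b t ≤ |a s - a t| := (le_abs_self _).trans (h s t)
  rw [← hs, ← ht]
  rcases abs_cases (a s - a t) with ⟨ha, -⟩ | ⟨ha, -⟩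
  · linarith [Finite.le_ciSup (fun t => c t + a t) s, Finite.le_ciSup (fun t => c t - a t) t]
  · linarith [Finite.le_ciSup (fun t => c t + a t) t, Finite.le_ciSup (fun t => c t - a t) s]

end FiniteSuprema

section Integrals

variable {Ω V W : Type*} [MeasurableSpace Ω] {Pr : Measure Ω}

lemma integrable_comp_of_lipschitzWith [IsFiniteMeasure Pr] [NormedAddCommGroup V]
    [NormedAddCommGroup W] {K : NNReal} {H : V → W} (hH : LipschitzWith K H) {U : Ω → V}
    (hU : Integrable U Pr) : Integrable (fun ω => H (U ω)) Pr := by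
  refine Integrable.mono' ((hU.norm.const_mul (K : ℝ)).add (integrable_const ‖H 0‖))
    (hH.continuous.comp_aestronglyMeasurable hU.1) (ae_of_all _ fun ω => ?_)
  have hlip := hH.norm_sub_le (U ω) 0
  rw [sub_zero] at hlip
  simp only [Pi.add_apply]
  linarith [norm_le_norm_add_norm_sub' (H (U ω)) (H 0)]

lemma integrable_iSup [IsFiniteMeasure Pr] {T : Type*} [Fintype T] [Nonempty T] {U : Ω → T → ℝ}
    (hU : Integrable U Pr) : Integrable (fun ω => ⨆ t, U ω t) Pr :=
  integrable_comp_of_lipschitzWith lipschitzWith_iSup hU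

lemma integral_comp_prodMk_of_indepFun [IsProbabilityMeasure Pr] [MeasurableSpace V]
    [MeasurableSpace W] {G : Type*} [NormedAddCommGroup G] [NormedSpace ℝ G]
    {U : Ω → V} {R : Ω → W} (hU : Measurable U) (hR : Measurable R) (h : IndepFun U R Pr)
    {K : V × W → G} (hK : StronglyMeasurable K) (hint : Integrable (fun ω => K (U ω, R ω)) Pr) :
    ∫ ω, K (U ω, R ω) ∂Pr = ∫ ω, ∫ ω', K (U ω', R ω) ∂Pr ∂Pr := by
  have hUR : Measurable fun ω => (U ω, R ω) := hU.prodMk hR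
  have hmap := h.map_prod_eq_prod_map_map hU.aemeasurable hR.aemeasurable
  have := Measure.isProbabilityMeasure_map (μ := Pr) hU.aemeasurable
  have := Measure.isProbabilityMeasure_map (μ := Pr) hR.aemeasurable
  have hint' : Integrable K ((Pr.map U).prod (Pr.map R)) := by
    rw [← hmap]
    exact (integrable_map_measure hK.aestronglyMeasurable hUR.aemeasurable).2 hint
  rw [← integral_map hUR.aemeasurable (f := K) hK.aestronglyMeasurable, hmap,
    integral_prod_symm _ hint', integral_map hR.aemeasurable]
  · congr 1 with ω
    rw [integral_map hU.aemeasurable]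
    exact (hK.comp_measurable measurable_prodMk_right).aestronglyMeasurable
  · exact hint'.integral_prod_right.aestronglyMeasurable

end Integrals

section Symmetrization

variable {T : Type*} [Fintype T] [Nonempty T] {Ω : Type*} [MeasurableSpace Ω] {Pr : Measure Ω}
  [IsProbabilityMeasure Pr]

lemma integral_iSup_add_sub_integral_le {U : Ω → T → ℝ} (hU : Integrable U Pr) (c : T → ℝ) :
    ∫ ω, ⨆ t, (c t + (U ω t - ∫ ω', U ω' t ∂Pr)) ∂Pr
      ≤ 2⁻¹ * (∫ ω, ⨆ t, (c t + 2 * U ω t) ∂Pr + ∫ ω, ⨆ t, (c t - 2 * U ω t) ∂Pr) := by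
  have hc : Integrable (fun _ : Ω => c) Pr := integrable_const c
  have hmean : Integrable (fun _ : Ω => fun t => ∫ ω', U ω' t ∂Pr) Pr := integrable_const _
  have hcenter : Integrable (fun ω => ⨆ t, (c t + (U ω t - ∫ ω', U ω' t ∂Pr))) Pr :=
    integrable_iSup (hc.add (hU.sub hmean))
  have hadd : Integrable (fun ω => ⨆ t, (c t + 2 * U ω t)) Pr :=
    integrable_iSup (hc.add (hU.smul (2 : ℝ)))
  have hsub : Integrable (fun ω => ⨆ t, (c t - 2 * U ω t)) Pr :=
    integrable_iSup (hc.sub (hU.smul (2 : ℝ)))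
  have hcoord : ∀ t, c t - 2 * ∫ ω, U ω t ∂Pr ≤ ∫ ω, ⨆ t, (c t - 2 * U ω t) ∂Pr := fun t => by
    have hUt : Integrable (fun ω => U ω t) Pr := hU.eval t
    have hmono : ∫ ω, (c t - 2 * U ω t) ∂Pr ≤ ∫ ω, ⨆ t, (c t - 2 * U ω t) ∂Pr :=
      integral_mono ((integrable_const _).sub (hUt.const_mul 2)) hsub
        fun ω => Finite.le_ciSup (fun t => c t - 2 * U ω t) t
    simpa [integral_sub (integrable_const (c t)) (hUt.const_mul 2), integral_const_mul] using hmono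
  have hpointwise : ∀ ω, ⨆ t, (c t + (U ω t - ∫ ω', U ω' t ∂Pr))
      ≤ 2⁻¹ * ((⨆ t, (c t + 2 * U ω t)) + ∫ ω', ⨆ t, (c t - 2 * U ω' t) ∂Pr) := fun ω =>
    ciSup_le fun t => by linarith [hcoord t, Finite.le_ciSup (fun t => c t + 2 * U ω t) t]
  refine (integral_mono hcenter ((hadd.add (integrable_const _)).const_mul _)
    hpointwise).trans_eq ?_
  simp [integral_const_mul, integral_add hadd (integrable_const _)]

lemma integral_iSup_contraction_le {U D : Ω → T → ℝ} (hU : Integrable U Pr) (hD : Integrable D Pr)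
    (h : ∀ ω s t, |U ω s - U ω t| ≤ |D ω s - D ω t|) (c : T → ℝ) :
    ∫ ω, ⨆ t, (c t + U ω t) ∂Pr + ∫ ω, ⨆ t, (c t - U ω t) ∂Pr
      ≤ ∫ ω, ⨆ t, (c t + D ω t) ∂Pr + ∫ ω, ⨆ t, (c t - D ω t) ∂Pr := by
  have hc : Integrable (fun _ : Ω => c) Pr := integrable_const c
  have hadd : ∀ {V : Ω → T → ℝ}, Integrable V Pr → Integrable (fun ω => ⨆ t, (c t + V ω t)) Pr :=
    fun hV => integrable_iSup (hc.add hV)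
  have hsub : ∀ {V : Ω → T → ℝ}, Integrable V Pr → Integrable (fun ω => ⨆ t, (c t - V ω t)) Pr :=
    fun hV => integrable_iSup (hc.sub hV)
  rw [← integral_add (hadd hU) (hsub hU), ← integral_add (hadd hD) (hsub hD)]
  exact integral_mono ((hadd hU).add (hsub hU)) ((hadd hD).add (hsub hD))
    fun ω => iSup_add_add_iSup_sub_le (h ω)

end Symmetrization

section Replacement

variable {V ι Ω Ω' : Type*} [NormedAddCommGroup V] [MeasurableSpace Ω] [MeasurableSpace Ω']
  {Pr : Measure Ω} {Pr' : Measure Ω'} [IsProbabilityMeasure Pr] [IsProbabilityMeasure Pr']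
  {K : NNReal} {H : V → ℝ}

lemma integrable_prod_comp_add (hH : LipschitzWith K H) {U : Ω → V} {U' : Ω' → V}
    (hU : Integrable U Pr) (hU' : Integrable U' Pr') (c : V) :
    Integrable (fun p : Ω × Ω' => H (c + (U' p.2 + U p.1))) (Pr.prod Pr') :=
  integrable_comp_of_lipschitzWith hH
    ((integrable_const c).add ((hU'.comp_snd Pr).add (hU.comp_fst Pr')))

variable [MeasurableSpace V] [BorelSpace V] [SecondCountableTopology V]

lemma integral_comp_add_add_le_of_indepFun (hH : LipschitzWith K H) {U S : Ω → V} {U' S' : Ω' → V}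
    (mU : Measurable U) (mS : Measurable S) (mU' : Measurable U') (mS' : Measurable S')
    (hU : Integrable U Pr) (hS : Integrable S Pr) (hU' : Integrable U' Pr')
    (hS' : Integrable S' Pr')
    (hind : IndepFun U S Pr) (hind' : IndepFun U' S' Pr')
    (hle : ∀ c, ∫ ω, H (c + U ω) ∂Pr ≤ ∫ ω, H (c + U' ω) ∂Pr')
    (hle' : ∀ c, ∫ ω, H (c + S ω) ∂Pr ≤ ∫ ω, H (c + S' ω) ∂Pr') (c : V) :
    ∫ ω, H (c + (U ω + S ω)) ∂Pr ≤ ∫ ω, H (c + (U' ω + S' ω)) ∂Pr' := by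
  have mH : StronglyMeasurable fun p : V × V => H (c + (p.1 + p.2)) :=
    (hH.continuous.comp (by fun_prop)).stronglyMeasurable
  have hmixed := integrable_prod_comp_add hH hS hU' c
  have hpure := integrable_prod_comp_add hH hS hU c
  have hpure' := integrable_prod_comp_add hH hS' hU' c
  calc ∫ ω, H (c + (U ω + S ω)) ∂Pr
      = ∫ ω, ∫ ω', H (c + (U ω' + S ω)) ∂Pr ∂Pr :=
        integral_comp_prodMk_of_indepFun mU mS hind mH
          (integrable_comp_of_lipschitzWith hH ((integrable_const c).add (hU.add hS)))
    _ ≤ ∫ ω, ∫ ω', H (c + (U' ω' + S ω)) ∂Pr' ∂Pr := by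
        refine integral_mono hpure.integral_prod_left hmixed.integral_prod_left fun ω => ?_
        simpa only [add_assoc, add_comm (S ω)] using hle (c + S ω)
    _ = ∫ ω', ∫ ω, H (c + (U' ω' + S ω)) ∂Pr ∂Pr' := integral_integral_swap hmixed
    _ ≤ ∫ ω', ∫ ω, H (c + (U' ω' + S' ω)) ∂Pr' ∂Pr' := by
        refine integral_mono hmixed.integral_prod_right hpure'.integral_prod_right
          fun ω' => ?_
        simpa only [add_assoc] using hle' (c + U' ω')
    _ = ∫ ω, ∫ ω', H (c + (U' ω' + S' ω)) ∂Pr' ∂Pr' := (integral_integral_swap hpure').symm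
    _ = ∫ ω, H (c + (U' ω + S' ω)) ∂Pr' :=
        (integral_comp_prodMk_of_indepFun mU' mS' hind' mH
          (integrable_comp_of_lipschitzWith hH ((integrable_const c).add (hU'.add hS')))).symm

lemma integral_comp_add_sum_le_of_iIndepFun (hH : LipschitzWith K H)
    {U : ι → Ω → V} {U' : ι → Ω' → V} (mU : ∀ i, Measurable (U i)) (mU' : ∀ i, Measurable (U' i))
    (hU : ∀ i, Integrable (U i) Pr) (hU' : ∀ i, Integrable (U' i) Pr')
    (hind : iIndepFun U Pr) (hind' : iIndepFun U' Pr')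
    (hle : ∀ i c, ∫ ω, H (c + U i ω) ∂Pr ≤ ∫ ω, H (c + U' i ω) ∂Pr') (s : Finset ι) (c : V) :
    ∫ ω, H (c + ∑ i ∈ s, U i ω) ∂Pr ≤ ∫ ω, H (c + ∑ i ∈ s, U' i ω) ∂Pr' := by
  classical
  induction s using Finset.induction_on generalizing c with
  | empty => simp
  | insert a s ha ih =>
    simp only [Finset.sum_insert ha]
    refine integral_comp_add_add_le_of_indepFun hH (mU a)
      (Finset.measurable_fun_sum s fun i _ => mU i) (mU' a)
      (Finset.measurable_fun_sum s fun i _ => mU' i) (hU a)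
      (integrable_finsetSum s fun i _ => hU i) (hU' a) (integrable_finsetSum s fun i _ => hU' i)
      ?_ ?_ (hle a) ih c
    · simpa only [Finset.sum_fn] using (hind.indepFun_finsetSum_of_notMem mU ha).symm
    · simpa only [Finset.sum_fn] using (hind'.indepFun_finsetSum_of_notMem mU' ha).symm

end Replacement

section BoundedDifferences

variable {V ι Ω : Type*} [NormedAddCommGroup V] [MeasurableSpace Ω] {Pr : Measure Ω}
  {H : V → ℝ} {K : NNReal}

lemma lipschitzWith_integral_comp_add [IsProbabilityMeasure Pr] (hH : LipschitzWith K H) {U : Ω → V}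
    (hint : ∀ v, Integrable (fun ω => H (U ω + v)) Pr) :
    LipschitzWith K fun v => ∫ ω, H (U ω + v) ∂Pr := by
  refine LipschitzWith.of_le_add_mul K fun v w => ?_
  calc ∫ ω, H (U ω + v) ∂Pr ≤ ∫ ω, (H (U ω + w) + K * dist v w) ∂Pr :=
        integral_mono (hint v) ((hint w).add (integrable_const _)) fun ω => by
          simpa only [dist_add_left] using hH.le_add_mul (U ω + v) (U ω + w)
    _ = ∫ ω, H (U ω + w) ∂Pr + K * dist v w := by
        simp [integral_add (hint w) (integrable_const _)]

variable [MeasurableSpace V] [BorelSpace V] [SecondCountableTopology V]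

lemma integrable_exp_mul_sub_comp_add (hH : LipschitzWith K H) {U R : Ω → V}
    (mU : Measurable U) (mR : Measurable R) {a : V} {r : ℝ}
    (hU : ∀ ω, U ω ∈ Metric.closedBall a r)
    {b t : ℝ} (hexp : Integrable (fun ω => Real.exp (t * (H (a + R ω) - b))) Pr) (m : ℝ) :
    Integrable (fun ω => Real.exp (t * (H (U ω + R ω) - m))) Pr := by
  have mH : Measurable fun ω => H (U ω + R ω) := hH.continuous.measurable.comp (mU.add mR)
  refine (hexp.const_mul (Real.exp (|t| * (K * r) + t * (b - m)))).mono'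
    ((mH.sub_const m).const_mul t).exp.aestronglyMeasurable (ae_of_all _ fun ω => ?_)
  have hdist : |H (U ω + R ω) - H (a + R ω)| ≤ K * r :=
    (hH.dist_le_mul _ _).trans (by rw [dist_add_right]; gcongr; exact hU ω)
  have hmul : t * (H (U ω + R ω) - H (a + R ω)) ≤ |t| * (K * r) :=
    (le_abs_self _).trans (by rw [abs_mul]; gcongr)
  rw [Real.norm_eq_abs, Real.abs_exp, ← Real.exp_add, Real.exp_le_exp]
  linarith

variable [IsProbabilityMeasure Pr]

lemma integrable_comp_add_of_mem_closedBall (hH : LipschitzWith K H) {U : Ω → V}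
    (mU : Measurable U) {a : V} {r : ℝ} (hU : ∀ ω, U ω ∈ Metric.closedBall a r) (v : V) :
    Integrable (fun ω => H (U ω + v)) Pr := by
  have hnorm : ∀ ω, ‖U ω‖ ≤ r + ‖a‖ := fun ω => by
    linarith [norm_le_norm_add_norm_sub' (U ω) a, mem_closedBall_iff_norm.1 (hU ω)]
  exact integrable_comp_of_lipschitzWith hH
    ((Integrable.of_bound mU.aestronglyMeasurable _ (ae_of_all _ hnorm)).add (integrable_const v))

lemma hasSubgaussianMGF_comp_add_of_mem_closedBall (hH : LipschitzWith K H) {U : Ω → V}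
    (mU : Measurable U) {a : V} {r : NNReal} (hU : ∀ ω, U ω ∈ Metric.closedBall a r) (v : V) :
    HasSubgaussianMGF (fun ω => H (U ω + v) - ∫ ω', H (U ω' + v) ∂Pr) ((K * r) ^ 2) Pr := by
  have hmem : ∀ ω, H (U ω + v) ∈ Set.Icc (H (a + v) - K * r) (H (a + v) + K * r) := fun ω => by
    have hdist : dist (H (U ω + v)) (H (a + v)) ≤ K * r :=
      (hH.dist_le_mul _ _).trans (by rw [dist_add_right]; gcongr; exact hU ω)
    rw [Real.dist_eq, abs_le] at hdist
    constructor <;> linarith [hdist.1, hdist.2]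
  convert hasSubgaussianMGF_of_mem_Icc
    (integrable_comp_add_of_mem_closedBall hH mU hU v).1.aemeasurable (ae_of_all Pr hmem) using 1
  rw [show H (a + v) + K * r - (H (a + v) - K * r) = ((2 * (K * r) : NNReal) : ℝ) by
    push_cast; ring, NNReal.nnnorm_eq, mul_div_cancel_left₀ _ two_ne_zero]

-- Hoeffding's lemma is applied to `U` with `R` frozen; the mean over `U` is again a Lipschitz
-- function of `R`.
lemma hasSubgaussianMGF_comp_add_of_indepFun (hH : LipschitzWith K H) {U R : Ω → V}
    (mU : Measurable U) (mR : Measurable R) (hind : IndepFun U R Pr) {a : V}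
    {r d : NNReal} (hU : ∀ ω, U ω ∈ Metric.closedBall a r)
    (hR : ∀ G : V → ℝ, LipschitzWith K G →
      HasSubgaussianMGF (fun ω => G (R ω) - ∫ ω', G (R ω') ∂Pr) d Pr) :
    HasSubgaussianMGF (fun ω => H (U ω + R ω) - ∫ ω', H (U ω' + R ω') ∂Pr)
      ((K * r) ^ 2 + d) Pr := by
  have hint := integrable_comp_add_of_mem_closedBall (Pr := Pr) hH mU hU
  set g : V → ℝ := fun v => ∫ ω, H (U ω + v) ∂Pr
  have hg : LipschitzWith K g := lipschitzWith_integral_comp_add hH hint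
  have mH : Measurable fun p : V × V => H (p.1 + p.2) :=
    hH.continuous.measurable.comp (by fun_prop)
  have hshift : LipschitzWith K fun v => H (a + v) := LipschitzWith.of_dist_le_mul fun v w => by
    simpa using hH.dist_le_mul (a + v) (a + w)
  have hexp : ∀ m t, Integrable (fun ω => Real.exp (t * (H (U ω + R ω) - m))) Pr := fun m t =>
    integrable_exp_mul_sub_comp_add hH mU mR hU ((hR _ hshift).integrable_exp_mul t) m
  have hHUR : Integrable (fun ω => H (U ω + R ω)) Pr := by
    have huniv : integrableExpSet (fun ω => H (U ω + R ω)) Pr = Set.univ :=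
      Set.eq_univ_of_forall fun t => by
        simpa only [integrableExpSet, Set.mem_ofPred_eq, sub_zero] using hexp 0 t
    exact integrable_of_mem_interior_integrableExpSet (by simp [huniv])
  have hmean : ∫ ω, H (U ω + R ω) ∂Pr = ∫ ω, g (R ω) ∂Pr :=
    integral_comp_prodMk_of_indepFun mU mR hind mH.stronglyMeasurable hHUR
  rw [hmean]
  set m := ∫ ω, g (R ω) ∂Pr
  have hcond : ∀ t v, ∫ ω, Real.exp (t * (H (U ω + v) - m)) ∂Pr
      ≤ Real.exp (((K * r) ^ 2 : NNReal) * t ^ 2 / 2) * Real.exp (t * (g v - m)) := fun t v => by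
    have hmgf := (hasSubgaussianMGF_comp_add_of_mem_closedBall (Pr := Pr) hH mU hU v).mgf_le t
    have hsplit : ∀ ω, Real.exp (t * (H (U ω + v) - m))
        = Real.exp (t * (H (U ω + v) - g v)) * Real.exp (t * (g v - m)) := fun ω => by
      rw [← Real.exp_add]; ring_nf
    simp only [hsplit, integral_mul_const]
    exact mul_le_mul_of_nonneg_right hmgf (Real.exp_pos _).le
  refine ⟨hexp m, fun t => ?_⟩
  calc mgf (fun ω => H (U ω + R ω) - m) Pr t
      = ∫ ω, ∫ ω', Real.exp (t * (H (U ω' + R ω) - m)) ∂Pr ∂Pr :=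
        integral_comp_prodMk_of_indepFun mU mR hind
          ((mH.sub_const m).const_mul t).exp.stronglyMeasurable (hexp m t)
    _ ≤ ∫ ω, Real.exp (((K * r) ^ 2 : NNReal) * t ^ 2 / 2) * Real.exp (t * (g (R ω) - m)) ∂Pr :=
        integral_mono_of_nonneg (ae_of_all _ fun ω => integral_nonneg fun _ => (Real.exp_pos _).le)
          (((hR g hg).integrable_exp_mul t).const_mul _) (ae_of_all _ fun ω => hcond t _)
    _ ≤ Real.exp (((K * r) ^ 2 : NNReal) * t ^ 2 / 2) * Real.exp (d * t ^ 2 / 2) := by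
        rw [integral_const_mul]
        exact mul_le_mul_of_nonneg_left ((hR g hg).mgf_le t) (Real.exp_pos _).le
    _ = _ := by
        rw [← Real.exp_add, NNReal.coe_add]
        ring_nf

theorem hasSubgaussianMGF_comp_sum_of_iIndepFun (hH : LipschitzWith K H) {U : ι → Ω → V}
    (mU : ∀ i, Measurable (U i)) (hind : iIndepFun U Pr) {a : ι → V} {r : ι → NNReal}
    (hU : ∀ i ω, U i ω ∈ Metric.closedBall (a i) (r i)) (s : Finset ι) :
    HasSubgaussianMGF (fun ω => H (∑ i ∈ s, U i ω) - ∫ ω', H (∑ i ∈ s, U i ω') ∂Pr)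
      (∑ i ∈ s, (K * r i) ^ 2) Pr := by
  classical
  induction s using Finset.induction_on generalizing H with
  | empty => simp
  | insert i s hi ih =>
    simp only [Finset.sum_insert hi]
    refine hasSubgaussianMGF_comp_add_of_indepFun hH (mU i)
      (Finset.measurable_fun_sum s fun j _ => mU j) ?_ (hU i) fun G hG => ih hG
    simpa only [Finset.sum_fn] using (hind.indepFun_finsetSum_of_notMem mU hi).symm

end BoundedDifferences

section Independence

variable {Ω Ω' ι κ : Type*} [MeasurableSpace Ω] [MeasurableSpace Ω'] {Pr : Measure Ω}
  {ν : Measure Ω'}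

lemma iIndepFun_prodMk_prod [Finite ι] [IsProbabilityMeasure Pr] [IsProbabilityMeasure ν]
    {V W : Type*} [MeasurableSpace V] [MeasurableSpace W] {h : ι → Ω → V} {σ : ι → Ω' → W}
    (mh : ∀ i, Measurable (h i)) (mσ : ∀ i, Measurable (σ i))
    (ih : iIndepFun h Pr) (iσ : iIndepFun σ ν) :
    iIndepFun (fun i (p : Ω × Ω') => (h i p.1, σ i p.2)) (Pr.prod ν) := by
  have := Fintype.ofFinite ι
  have := fun i => Measure.isProbabilityMeasure_map (μ := Pr) (mh i).aemeasurable
  have := fun i => Measure.isProbabilityMeasure_map (μ := ν) (mσ i).aemeasurable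
  have mpair : ∀ i, Measurable fun p : Ω × Ω' => (h i p.1, σ i p.2) := fun i =>
    ((mh i).comp measurable_fst).prodMk ((mσ i).comp measurable_snd)
  have hmarginal : ∀ i, (Pr.prod ν).map (fun p => (h i p.1, σ i p.2))
      = (Pr.map (h i)).prod (ν.map (σ i)) := fun i =>
    (Measure.map_prod_map Pr ν (mh i) (mσ i)).symm
  have hjoint := Measure.map_prod_map Pr ν (measurable_pi_lambda (fun ω i => h i ω) mh)
    (measurable_pi_lambda (fun ω i => σ i ω) mσ)
  rw [ih.map_fun_eq_pi_map fun i => (mh i).aemeasurable,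
    iσ.map_fun_eq_pi_map fun i => (mσ i).aemeasurable] at hjoint
  rw [iIndepFun_iff_map_fun_eq_pi_map fun i => (mpair i).aemeasurable]
  simp only [hmarginal]
  rw [← (measurePreserving_arrowProdEquivProdArrow V W ι (fun i => Pr.map (h i))
      (fun i => ν.map (σ i))).symm.map_eq, hjoint,
    Measure.map_map (MeasurableEquiv.measurable _) (by fun_prop)]
  rfl

lemma iIndepFun_restrict_of_pairwise_disjoint {β : ι → Type*} [∀ i, MeasurableSpace (β i)]
    {Y : ∀ i, Ω → β i} (mY : ∀ i, Measurable (Y i)) (hY : iIndepFun Y Pr) {b : κ → Finset ι}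
    (hb : Pairwise fun s t => Disjoint (b s) (b t)) :
    iIndepFun (fun s ω => (b s).restrict fun i => Y i ω) Pr := by
  classical
  have := hY.isProbabilityMeasure
  refine iIndepFun_iff_measure_inter_preimage_eq_mul.2 fun S A hA => ?_
  induction S using Finset.induction_on with
  | empty => simp
  | insert a S ha ih =>
    have hdisj : Disjoint (b a) (S.biUnion b) := (Finset.disjoint_biUnion_right _ _ _).2
      fun s hs => hb fun has => ha (has ▸ hs)
    have hrestrict : ∀ s ∈ S, b s ⊆ S.biUnion b := fun s hs => Finset.subset_biUnion_of_mem b hs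
    have hpre : ⋂ s ∈ S, (fun ω => (b s).restrict fun i => Y i ω) ⁻¹' A s
        = (fun ω (i : S.biUnion b) => Y i ω) ⁻¹'
          ⋂ s : S, Finset.restrict₂ (π := β) (hrestrict s s.2) ⁻¹' A s := by
      ext ω
      simp [Finset.restrict_def, Finset.restrict₂_def]
    have hmeas : MeasurableSet
        (⋂ s : S, Finset.restrict₂ (π := β) (hrestrict s s.2) ⁻¹' A s) :=
      MeasurableSet.iInter fun s =>
        Finset.measurable_restrict₂ _ (hA s (Finset.mem_insert_of_mem s.2))
    rw [Finset.set_biInter_insert, Finset.prod_insert ha,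
      ← ih fun s hs => hA s (Finset.mem_insert_of_mem hs), hpre]
    exact (hY.indepFun_finset _ _ hdisj mY).measure_inter_preimage_eq_mul _ _
      (hA a (Finset.mem_insert_self a S)) hmeas

lemma iIndepFun_sum_of_pairwise_disjoint {V : Type*}
    [MeasurableSpace V] [AddCommMonoid V] [MeasurableAdd₂ V] {Y : ι → Ω → V}
    (mY : ∀ i, Measurable (Y i)) (hY : iIndepFun Y Pr) {b : κ → Finset ι}
    (hb : Pairwise fun s t => Disjoint (b s) (b t)) :
    iIndepFun (fun s ω => ∑ i ∈ b s, Y i ω) Pr := by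
  have hsum := (iIndepFun_restrict_of_pairwise_disjoint mY hY hb).comp
    (fun s (y : b s → V) => ∑ i, y i) fun s => by fun_prop
  refine hsum.congr fun s => ae_of_all _ fun ω => ?_
  exact Finset.sum_coe_sort (b s) fun i => Y i ω

end Independence

section Signs

instance isProbabilityMeasure_rademacher : IsProbabilityMeasure rademacher := by
  constructor
  simp only [rademacher, Measure.smul_apply, Measure.add_apply, measure_univ, smul_eq_mul]
  rw [one_add_one_eq_two]
  exact ENNReal.inv_mul_cancel two_ne_zero ENNReal.ofNat_ne_top

lemma integral_rademacher (f : ℝ → ℝ) : ∫ x, f x ∂rademacher = 2⁻¹ * (f 1 + f (-1)) := by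
  rw [rademacher, integral_smul_measure, integral_add_measure, integral_dirac, integral_dirac]
  · simp
  · exact integrable_dirac (by simp)
  · exact integrable_dirac (by simp)

lemma ae_abs_eq_one_rademacher : ∀ᵐ x ∂rademacher, |x| = 1 := by
  rw [rademacher, ae_iff]
  simp

variable {T : Type*} [Fintype T] {Ω Ω' : Type*} [MeasurableSpace Ω] [MeasurableSpace Ω']
  {Pr : Measure Ω} {ν : Measure Ω'} {σ : Ω' → ℝ} {D : Ω → T → ℝ}

lemma integrable_sign_smul [IsFiniteMeasure ν] (mσ : Measurable σ) (hlaw : ν.map σ = rademacher)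
    (hD : Integrable D Pr) : Integrable (fun p : Ω × Ω' => σ p.2 • D p.1) (Pr.prod ν) := by
  refine (hD.comp_fst ν).mono ?_ ?_
  · exact (mσ.comp measurable_snd).aestronglyMeasurable.smul hD.1.comp_fst
  · have hσ : ∀ᵐ y ∂ν, |σ y| = 1 :=
      ae_of_ae_map mσ.aemeasurable (hlaw ▸ ae_abs_eq_one_rademacher)
    filter_upwards [Measure.quasiMeasurePreserving_snd.ae hσ] with p hp
    rw [norm_smul, Real.norm_eq_abs, hp, one_mul]

variable [Nonempty T] [IsProbabilityMeasure Pr] [IsProbabilityMeasure ν]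

lemma integral_iSup_add_sign_smul (mσ : Measurable σ) (hlaw : ν.map σ = rademacher)
    (mD : Measurable D) (hD : Integrable D Pr) (c : T → ℝ) :
    ∫ p, ⨆ t, (c + σ p.2 • D p.1) t ∂(Pr.prod ν)
      = 2⁻¹ * (∫ ω, ⨆ t, (c + D ω) t ∂Pr + ∫ ω, ⨆ t, (c - D ω) t ∂Pr) := by
  have hint : Integrable (fun p : Ω × Ω' => ⨆ t, (c + σ p.2 • D p.1) t) (Pr.prod ν) :=
    integrable_iSup ((integrable_const c).add (integrable_sign_smul mσ hlaw hD))
  have hmeas : StronglyMeasurable fun x : ℝ => ∫ ω, ⨆ t, (c + x • D ω) t ∂Pr := by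
    have hjoint : Measurable (Function.uncurry fun (x : ℝ) (ω : Ω) => ⨆ t, (c + x • D ω) t) :=
      lipschitzWith_iSup.continuous.measurable.comp
        (measurable_const.add (measurable_fst.smul (mD.comp measurable_snd)))
    exact hjoint.stronglyMeasurable.integral_prod_right
  rw [integral_prod_symm _ hint,
    ← integral_map mσ.aemeasurable (f := fun x : ℝ => ∫ ω, ⨆ t, (c + x • D ω) t ∂Pr)
      hmeas.aestronglyMeasurable, hlaw, integral_rademacher]
  simp [sub_eq_add_neg]

lemma integral_iSup_add_sub_integral_le_sign_smul (mσ : Measurable σ)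
    (hlaw : ν.map σ = rademacher) {U : Ω → T → ℝ} (hU : Integrable U Pr) (mD : Measurable D)
    (hD : Integrable D Pr) (h : ∀ ω s t, |U ω s - U ω t| ≤ |D ω s - D ω t|) (c : T → ℝ) :
    ∫ ω, ⨆ t, (c + (U ω - fun t => ∫ ω', U ω' t ∂Pr)) t ∂Pr
      ≤ ∫ p, ⨆ t, (c + σ p.2 • (2 : ℝ) • D p.1) t ∂(Pr.prod ν) := by
  have hcontract := integral_iSup_contraction_le (hU.smul (2 : ℝ)) (hD.smul (2 : ℝ))
    (fun ω s t => by
      simp only [Pi.smul_apply, smul_eq_mul, ← mul_sub, abs_mul]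
      exact mul_le_mul_of_nonneg_left (h ω s t) (abs_nonneg 2)) c
  refine (integral_iSup_add_sub_integral_le hU c).trans ?_
  rw [integral_iSup_add_sign_smul (Pr := Pr) (D := fun ω => (2 : ℝ) • D ω) mσ hlaw
    (mD.const_smul (2 : ℝ)) (hD.smul (2 : ℝ))]
  exact mul_le_mul_of_nonneg_left hcontract (by norm_num)

end Signs

section CenteredSums

variable {T Ω ι κ : Type*} [MeasurableSpace Ω]

/-- The sum over the block `s` of the centered random vectors `g i`. -/
def centeredSum (Pr : Measure Ω) (g : ι → Ω → T → ℝ) (s : Finset ι) (ω : Ω) : T → ℝ :=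
  ∑ i ∈ s, (g i ω - fun t => ∫ ω', g i ω' t ∂Pr)

variable {Pr : Measure Ω} {g : ι → Ω → T → ℝ}

lemma centeredSum_apply (s : Finset ι) (ω : Ω) (t : T) :
    centeredSum Pr g s ω t = ∑ i ∈ s, (g i ω t - ∫ ω', g i ω' t ∂Pr) := by
  simp [centeredSum]

lemma centeredSum_const_smul (x : ℝ) (s : Finset ι) (ω : Ω) :
    centeredSum Pr (fun i ω => x • g i ω) s ω = x • centeredSum Pr g s ω := by
  ext t
  simp only [centeredSum_apply, Pi.smul_apply, smul_eq_mul, integral_const_mul, ← mul_sub,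
    Finset.mul_sum]

lemma measurable_centeredSum (mg : ∀ i, Measurable (g i)) (s : Finset ι) :
    Measurable (centeredSum Pr g s) :=
  Finset.measurable_fun_sum s fun i _ => (mg i).sub_const _

lemma integral_sq_centeredSum [IsProbabilityMeasure Pr]
    (hg : ∀ i t, MemLp (fun ω => g i ω t) 2 Pr) (hind : iIndepFun g Pr) (s : Finset ι) (t : T) :
    ∫ ω, centeredSum Pr g s ω t ^ 2 ∂Pr = ∑ i ∈ s, variance (fun ω => g i ω t) Pr := by
  have hint : ∀ i, Integrable (fun ω => g i ω t) Pr := fun i => (hg i t).integrable one_le_two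
  have hcenter : ∀ i, MemLp (fun ω => g i ω t - ∫ ω', g i ω' t ∂Pr) 2 Pr := fun i =>
    (hg i t).sub (memLp_const _)
  have hmean : ∫ ω, ∑ i ∈ s, (g i ω t - ∫ ω', g i ω' t ∂Pr) ∂Pr = 0 := by
    rw [integral_finsetSum _ fun i _ => (hcenter i).integrable one_le_two]
    exact Finset.sum_eq_zero fun i _ => by simp [integral_sub (hint i) (integrable_const _)]
  have hpairwise : Set.Pairwise (s : Set ι) fun i j =>
      IndepFun (fun ω => g i ω t - ∫ ω', g i ω' t ∂Pr)
        (fun ω => g j ω t - ∫ ω', g j ω' t ∂Pr) Pr := fun i _ j _ hij =>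
    (hind.indepFun hij).comp (φ := fun v : T → ℝ => v t - ∫ ω', g i ω' t ∂Pr)
      (ψ := fun v : T → ℝ => v t - ∫ ω', g j ω' t ∂Pr) (by fun_prop) (by fun_prop)
  have hvar := IndepFun.variance_sum (fun i _ => hcenter i) hpairwise
  rw [Finset.sum_fn, variance_of_integral_eq_zero
    (memLp_finsetSum _ fun i _ => hcenter i).aestronglyMeasurable.aemeasurable hmean] at hvar
  simpa only [centeredSum_apply, variance_sub_const (hg _ t).aestronglyMeasurable] using hvar

lemma iIndepFun_centeredSum (mg : ∀ i, Measurable (g i)) (hind : iIndepFun g Pr)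
    {b : κ → Finset ι} (hb : Pairwise fun s t => Disjoint (b s) (b t)) :
    iIndepFun (fun s => centeredSum Pr g (b s)) Pr :=
  iIndepFun_sum_of_pairwise_disjoint (fun i => (mg i).sub_const _)
    (hind.comp (fun i v => v - fun t => ∫ ω', g i ω' t ∂Pr) fun _ => measurable_id.sub_const _) hb

variable [Fintype T]

lemma integrable_centeredSum [IsFiniteMeasure Pr] (hg : ∀ i, Integrable (g i) Pr) (s : Finset ι) :
    Integrable (centeredSum Pr g s) Pr :=
  integrable_finsetSum s fun i _ => (hg i).sub (integrable_const _)

end CenteredSums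

section BlockSymmetrization

variable {T Ω Ω' ι κ : Type*} [Finite ι] [MeasurableSpace Ω] [MeasurableSpace Ω']
  {Pr : Measure Ω} {ν : Measure Ω'} [IsProbabilityMeasure Pr] [IsProbabilityMeasure ν]
  {g h : ι → Ω → T → ℝ} {σ : ι → Ω' → ℝ}

lemma iIndepFun_sign_smul [Finite T] (mh : ∀ i, Measurable (h i)) (mσ : ∀ i, Measurable (σ i))
    (ih : iIndepFun h Pr) (iσ : iIndepFun σ ν) :
    iIndepFun (fun i (p : Ω × Ω') => σ i p.2 • h i p.1) (Pr.prod ν) :=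
  (iIndepFun_prodMk_prod mh mσ ih iσ).comp (fun _ q => q.2 • q.1)
    fun _ => measurable_snd.smul measurable_fst

variable [Fintype T] [Nonempty T]

lemma integral_iSup_add_centeredSum_le (mg : ∀ i, Measurable (g i)) (mh : ∀ i, Measurable (h i))
    (mσ : ∀ i, Measurable (σ i)) (hg : ∀ i, Integrable (g i) Pr) (hh : ∀ i, Integrable (h i) Pr)
    (hlaw : ∀ i, ν.map (σ i) = rademacher) (ig : iIndepFun g Pr) (ih : iIndepFun h Pr)
    (iσ : iIndepFun σ ν) (hgh : ∀ i ω s t, |g i ω s - g i ω t| ≤ |h i ω s - h i ω t|)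
    (s : Finset ι) (c : T → ℝ) :
    ∫ ω, ⨆ t, (c + centeredSum Pr g s ω) t ∂Pr
      ≤ ∫ p, ⨆ t, (c + ∑ i ∈ s, σ i p.2 • (2 : ℝ) • h i p.1) t ∂(Pr.prod ν) := by
  have ih₂ : iIndepFun (fun i ω => (2 : ℝ) • h i ω) Pr :=
    ih.comp (fun _ v => (2 : ℝ) • v) fun _ => measurable_const_smul _
  exact integral_comp_add_sum_le_of_iIndepFun
    (U := fun i ω => g i ω - fun t => ∫ ω', g i ω' t ∂Pr)
    (U' := fun i (p : Ω × Ω') => σ i p.2 • (2 : ℝ) • h i p.1)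
    lipschitzWith_iSup (fun i => (mg i).sub_const _)
    (fun i => by fun_prop)
    (fun i => (hg i).sub (integrable_const _))
    (fun i => integrable_sign_smul (mσ i) (hlaw i) ((hh i).smul (2 : ℝ)))
    (ig.comp (fun i v => v - fun t => ∫ ω', g i ω' t ∂Pr) fun _ => measurable_id.sub_const _)
    (iIndepFun_sign_smul (fun i => (mh i).const_smul (2 : ℝ)) mσ ih₂ iσ)
    (fun i c => integral_iSup_add_sub_integral_le_sign_smul (mσ i) (hlaw i) (hg i) (mh i) (hh i)
      (hgh i) c) s c

lemma integral_iSup_add_comp_centeredSum_sub_integral_le (mg : ∀ i, Measurable (g i))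
    (mh : ∀ i, Measurable (h i)) (mσ : ∀ i, Measurable (σ i)) (hg : ∀ i, Integrable (g i) Pr)
    (hh : ∀ i, Integrable (h i) Pr) (hlaw : ∀ i, ν.map (σ i) = rademacher) (ig : iIndepFun g Pr)
    (ih : iIndepFun h Pr) (iσ : iIndepFun σ ν)
    (hgh : ∀ i ω s t, |g i ω s - g i ω t| ≤ |h i ω s - h i ω t|) {a : NNReal} {ψ : ℝ → ℝ}
    (hψ : LipschitzWith a ψ) (s : Finset ι) (c : T → ℝ) :
    ∫ ω, ⨆ t, (c + ((fun t => ψ (centeredSum Pr g s ω t))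
        - fun t => ∫ ω', ψ (centeredSum Pr g s ω' t) ∂Pr)) t ∂Pr
      ≤ ∫ p, ⨆ t, (c + ∑ i ∈ s, σ i p.2 • (4 * a : ℝ) • h i p.1) t ∂(Pr.prod ν) := by
  have hW : Integrable (centeredSum Pr g s) Pr := integrable_centeredSum hg s
  have hψW : Integrable (fun ω t => ψ (centeredSum Pr g s ω t)) Pr :=
    Integrable.of_eval fun t => integrable_comp_of_lipschitzWith hψ (hW.eval t)
  have hscaled : ∀ x : ℝ, |x| = 2 * a → ∫ ω, ⨆ t, (c + x • centeredSum Pr g s ω) t ∂Pr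
      ≤ ∫ p, ⨆ t, (c + ∑ i ∈ s, σ i p.2 • (4 * a : ℝ) • h i p.1) t ∂(Pr.prod ν) := fun x hx => by
    have hinner := integral_iSup_add_centeredSum_le (Pr := Pr) (ν := ν)
      (g := fun i ω => x • g i ω) (h := fun i ω => (2 * a : ℝ) • h i ω)
      (fun i => (mg i).const_smul x) (fun i => (mh i).const_smul (2 * a : ℝ)) mσ
      (fun i => (hg i).smul x) (fun i => (hh i).smul (2 * a : ℝ)) hlaw
      (ig.comp (fun _ v => x • v) fun _ => measurable_const_smul x)
      (ih.comp (fun _ v => (2 * a : ℝ) • v) fun _ => measurable_const_smul _) iσ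
      (fun i ω s t => by
        simp only [Pi.smul_apply, smul_eq_mul, ← mul_sub, abs_mul, hx]
        rw [← abs_mul, abs_of_nonneg (by positivity : (0 : ℝ) ≤ 2 * a)]
        exact mul_le_mul_of_nonneg_left (hgh i ω s t) (by positivity)) s c
    simpa only [centeredSum_const_smul, smul_smul, ← mul_assoc,
      show (2 * 2 : ℝ) = 4 by norm_num] using hinner
  have hcontract := integral_iSup_contraction_le (Pr := Pr)
    (U := fun ω => (2 : ℝ) • fun t => ψ (centeredSum Pr g s ω t))
    (D := fun ω => (2 * a : ℝ) • centeredSum Pr g s ω)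
    (hψW.smul (2 : ℝ)) (hW.smul (2 * a : ℝ)) (fun ω t₁ t₂ => by
      have hlip := hψ.dist_le_mul (centeredSum Pr g s ω t₁) (centeredSum Pr g s ω t₂)
      simp only [Real.dist_eq] at hlip
      simp only [Pi.smul_apply, smul_eq_mul, ← mul_sub, abs_mul, Nat.abs_ofNat, NNReal.abs_eq]
      linarith) c
  have hpos := hscaled (2 * a) (abs_of_nonneg (by positivity))
  have hneg := hscaled (-(2 * a)) ((abs_neg _).trans (abs_of_nonneg (by positivity)))
  simp only [neg_smul, ← sub_eq_add_neg] at hneg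
  have hsum := hcontract.trans (add_le_add hpos hneg)
  refine (integral_iSup_add_sub_integral_le hψW c).trans ?_
  exact (mul_le_mul_of_nonneg_left hsum (by norm_num)).trans (by linarith)

theorem integral_iSup_sum_comp_centeredSum_sub_integral_le [Fintype κ]
    (mg : ∀ i, Measurable (g i)) (mh : ∀ i, Measurable (h i)) (mσ : ∀ i, Measurable (σ i))
    (hg : ∀ i, Integrable (g i) Pr) (hh : ∀ i, Integrable (h i) Pr)
    (hlaw : ∀ i, ν.map (σ i) = rademacher) (ig : iIndepFun g Pr) (ih : iIndepFun h Pr)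
    (iσ : iIndepFun σ ν) (hgh : ∀ i ω s t, |g i ω s - g i ω t| ≤ |h i ω s - h i ω t|)
    {a : NNReal} {ψ : ℝ → ℝ} (hψ : LipschitzWith a ψ)
    {b : κ → Finset ι} (hb : Pairwise fun s t => Disjoint (b s) (b t)) :
    ∫ ω, ⨆ t, ∑ s, (ψ (centeredSum Pr g (b s) ω t)
        - ∫ ω', ψ (centeredSum Pr g (b s) ω' t) ∂Pr) ∂Pr
      ≤ 4 * a * ∫ p, ⨆ t, ∑ s, ∑ i ∈ b s, σ i p.2 * h i p.1 t ∂(Pr.prod ν) := by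
  have mψ : ∀ s, Measurable fun (v : T → ℝ) =>
      (fun t => ψ (v t)) - fun t => ∫ ω', ψ (centeredSum Pr g (b s) ω' t) ∂Pr := fun s =>
    (measurable_pi_lambda _ fun t =>
      hψ.continuous.measurable.comp (measurable_pi_apply t)).sub_const _
  have hψW : ∀ s, Integrable (fun ω t => ψ (centeredSum Pr g (b s) ω t)) Pr := fun s =>
    Integrable.of_eval fun t =>
      integrable_comp_of_lipschitzWith hψ ((integrable_centeredSum hg (b s)).eval t)
  have msign : ∀ i, Measurable fun p : Ω × Ω' => σ i p.2 • (4 * a : ℝ) • h i p.1 := fun i => by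
    fun_prop
  have isign := iIndepFun_sign_smul (fun i => (mh i).const_smul (4 * a : ℝ)) mσ
    (ih.comp (fun _ v => (4 * a : ℝ) • v) fun _ => measurable_const_smul _) iσ
  have hsum := integral_comp_add_sum_le_of_iIndepFun (Pr := Pr) (Pr' := Pr.prod ν)
    lipschitzWith_iSup (fun s => (mψ s).comp (measurable_centeredSum mg (b s)))
    (fun s => Finset.measurable_fun_sum (b s) fun i _ => msign i)
    (fun s => (hψW s).sub (integrable_const _))
    (fun s => integrable_finsetSum (b s) fun i _ =>
      integrable_sign_smul (mσ i) (hlaw i) ((hh i).smul (4 * a : ℝ)))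
    ((iIndepFun_centeredSum mg ig hb).comp _ mψ)
    (iIndepFun_sum_of_pairwise_disjoint msign isign hb)
    (fun s c => integral_iSup_add_comp_centeredSum_sub_integral_le mg mh mσ hg hh hlaw ig ih iσ hgh
      hψ (b s) c) Finset.univ 0
  rw [← integral_const_mul]
  simp only [Real.mul_iSup_of_nonneg (by positivity : (0 : ℝ) ≤ 4 * a), Finset.mul_sum]
  simpa [mul_left_comm] using hsum

end BlockSymmetrization

section UniformDeviation

variable {T Ω κ : Type*} [Finite T] [Nonempty T] [Fintype κ] [MeasurableSpace Ω]
  {Pr : Measure Ω} [IsProbabilityMeasure Pr] {U : κ → Ω → T → ℝ}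

lemma measureReal_iSup_sum_sub_integral_ge_le (mU : ∀ s, Measurable (U s))
    (hind : iIndepFun U Pr) (hU : ∀ s ω t, U s ω t ∈ Set.Icc (0 : ℝ) 1) {ε : ℝ} (hε : 0 ≤ ε) :
    Pr.real {ω | ε ≤ (⨆ t, ∑ s, (U s ω t - ∫ ω', U s ω' t ∂Pr))
        - ∫ ω', ⨆ t, ∑ s, (U s ω' t - ∫ ω'', U s ω'' t ∂Pr) ∂Pr}
      ≤ Real.exp (-(2 * ε ^ 2 / Fintype.card κ)) := by
  have := Fintype.ofFinite T
  have hball : ∀ s ω, U s ω ∈ Metric.closedBall (fun _ : T => (1 / 2 : ℝ)) (1 / 2 : NNReal) :=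
    fun s ω => (dist_pi_le_iff (by positivity)).2 fun t => by
      rw [Real.dist_eq, abs_le]
      push_cast
      constructor <;> linarith [(hU s ω t).1, (hU s ω t).2]
  have hLip : LipschitzWith 1 fun v : T → ℝ => ⨆ t, (v - fun t => ∑ s, ∫ ω, U s ω t ∂Pr) t := by
    refine LipschitzWith.of_dist_le_mul fun v w => ?_
    simpa only [dist_sub_right] using lipschitzWith_iSup.dist_le_mul
      (v - fun t => ∑ s, ∫ ω, U s ω t ∂Pr) (w - fun t => ∑ s, ∫ ω, U s ω t ∂Pr)
  have htail := (hasSubgaussianMGF_comp_sum_of_iIndepFun hLip mU hind hball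
    Finset.univ).measure_ge_le hε
  simp only [Pi.sub_apply, Finset.sum_apply, ← Finset.sum_sub_distrib] at htail
  refine htail.trans_eq ?_
  simp only [one_mul, Finset.sum_const, Finset.card_univ, nsmul_eq_mul]
  push_cast
  congr 1
  field

lemma measureReal_exists_sum_ge_le (mU : ∀ s, Measurable (U s)) (hind : iIndepFun U Pr)
    (hU : ∀ s ω t, U s ω t ∈ Set.Icc (0 : ℝ) 1) {p q ε : ℝ}
    (hmean : ∀ s t, ∫ ω, U s ω t ∂Pr ≤ p)
    (hsup : ∫ ω, ⨆ t, ∑ s, (U s ω t - ∫ ω', U s ω' t ∂Pr) ∂Pr ≤ q * Fintype.card κ)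
    (hε : 0 ≤ ε) :
    Pr.real {ω | ∃ t, (p + q + ε) * Fintype.card κ ≤ ∑ s, U s ω t}
      ≤ Real.exp (-(2 * ε ^ 2 * Fintype.card κ)) := by
  refine (measureReal_mono ?_).trans ((measureReal_iSup_sum_sub_integral_ge_le mU hind hU
    (mul_nonneg hε (Nat.cast_nonneg (Fintype.card κ)))).trans_eq ?_)
  · rintro ω ⟨t, ht⟩
    have hle := Finite.le_ciSup (fun t => ∑ s, (U s ω t - ∫ ω', U s ω' t ∂Pr)) t
    have hmeans : ∑ s, ∫ ω', U s ω' t ∂Pr ≤ p * Fintype.card κ := by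
      refine (Finset.sum_le_card_nsmul _ _ p fun s _ => hmean s t).trans_eq ?_
      rw [Finset.card_univ, nsmul_eq_mul, mul_comm]
    simp only [Finset.sum_sub_distrib] at hle hsup
    simp only [Set.mem_ofPred_eq, Finset.sum_sub_distrib]
    linarith
  · rcases Nat.eq_zero_or_pos (Fintype.card κ) with h0 | hpos
    · simp [h0]
    · congr 1
      field

end UniformDeviation

section Ramp

/-- A Lipschitz majorant of the indicator of `(-∞, -δ]` which vanishes on `[-δ/2, ∞)`. -/
def ramp (δ x : ℝ) : ℝ :=
  max 0 (min 1 (-(2 / δ) * x - 1))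

variable {δ : ℝ}

lemma ramp_mem_Icc (δ x : ℝ) : ramp δ x ∈ Set.Icc (0 : ℝ) 1 :=
  ⟨le_max_left _ _, max_le zero_le_one (min_le_left _ _)⟩

lemma one_le_ramp_of_le_neg (hδ : 0 < δ) {x : ℝ} (hx : x ≤ -δ) : 1 ≤ ramp δ x := by
  refine le_max_of_le_right (le_min le_rfl ?_)
  have : 2 / δ * δ ≤ 2 / δ * -x := mul_le_mul_of_nonneg_left (by linarith) (by positivity)
  rw [div_mul_cancel₀ _ hδ.ne'] at this
  linarith

lemma ramp_le_inv_mul_sq (δ x : ℝ) : ramp δ x ≤ (δ⁻¹ * x) ^ 2 := by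
  refine max_le (sq_nonneg _) ((min_le_right _ _).trans ?_)
  rw [div_eq_mul_inv]
  nlinarith [sq_nonneg (δ⁻¹ * x + 1)]

lemma lipschitzWith_ramp (δ : ℝ) : LipschitzWith ‖2 / δ‖₊ (ramp δ) := by
  have haffine : LipschitzWith ‖2 / δ‖₊ fun x : ℝ => -(2 / δ) * x - 1 := by
    refine LipschitzWith.of_dist_le_mul fun x y => le_of_eq ?_
    rw [dist_sub_right, Real.dist_eq, ← mul_sub, abs_mul, abs_neg]
    rfl
  exact (haffine.const_min 1).const_max 0

end Ramp

section BlockDeviation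

variable {T Ω Ω' ι κ : Type*} [MeasurableSpace Ω] [MeasurableSpace Ω'] {Pr : Measure Ω}
  [IsProbabilityMeasure Pr] {g h : ι → Ω → T → ℝ} {δ : ℝ}

lemma integral_ramp_centeredSum_le (hg : ∀ i t, MemLp (fun ω => g i ω t) 2 Pr)
    (hind : iIndepFun g Pr) (s : Finset ι) (t : T) :
    ∫ ω, ramp δ (centeredSum Pr g s ω t) ∂Pr
      ≤ δ⁻¹ ^ 2 * ∑ i ∈ s, variance (fun ω => g i ω t) Pr := by
  have hL2 : MemLp (fun ω => centeredSum Pr g s ω t) 2 Pr := by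
    simp only [centeredSum_apply]
    exact memLp_finsetSum s fun i _ => (hg i t).sub (memLp_const _)
  rw [← integral_sq_centeredSum hg hind, ← integral_const_mul]
  refine integral_mono_of_nonneg (ae_of_all _ fun ω => (ramp_mem_Icc δ _).1)
    (hL2.integrable_sq.const_mul _) (ae_of_all _ fun ω => ?_)
  simpa only [mul_pow] using ramp_le_inv_mul_sq δ (centeredSum Pr g s ω t)

variable {ν : Measure Ω'} [IsProbabilityMeasure ν] {σ : ι → Ω' → ℝ} [Finite ι] [Fintype T]
  [Nonempty T] [Fintype κ]

theorem measureReal_exists_card_centeredSum_le_le (mg : ∀ i, Measurable (g i))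
    (mh : ∀ i, Measurable (h i)) (mσ : ∀ i, Measurable (σ i))
    (hg : ∀ i t, MemLp (fun ω => g i ω t) 2 Pr) (hh : ∀ i, Integrable (h i) Pr)
    (hlaw : ∀ i, ν.map (σ i) = rademacher) (ig : iIndepFun g Pr) (ih : iIndepFun h Pr)
    (iσ : iIndepFun σ ν) (hgh : ∀ i ω s t, |g i ω s - g i ω t| ≤ |h i ω s - h i ω t|)
    {b : κ → Finset ι} (hb : Pairwise fun s t => Disjoint (b s) (b t)) (hδ : 0 < δ)
    (hvar : ∀ s t, ∑ i ∈ b s, variance (fun ω => g i ω t) Pr ≤ δ ^ 2 / 32)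
    (hrad : ∫ p, ⨆ t, ∑ s, ∑ i ∈ b s, σ i p.2 * h i p.1 t ∂(Pr.prod ν)
      ≤ δ * Fintype.card κ / 256) :
    Pr.real {ω | ∃ t, (Fintype.card κ : ℝ) / 8
        ≤ (Finset.univ.filter fun s => centeredSum Pr g (b s) ω t ≤ -δ).card}
      ≤ Real.exp (-(Fintype.card κ : ℝ) / 288) := by
  have hgint : ∀ i, Integrable (g i) Pr := fun i =>
    Integrable.of_eval fun t => (hg i t).integrable one_le_two
  have mramp : Measurable fun (v : T → ℝ) t => ramp δ (v t) :=
    measurable_pi_lambda _ fun t =>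
      (lipschitzWith_ramp δ).continuous.measurable.comp (measurable_pi_apply t)
  have hmean : ∀ s t, ∫ ω, ramp δ (centeredSum Pr g (b s) ω t) ∂Pr ≤ 1 / 32 := fun s t =>
    calc _ ≤ δ⁻¹ ^ 2 * (δ ^ 2 / 32) := (integral_ramp_centeredSum_le hg ig (b s) t).trans
          (mul_le_mul_of_nonneg_left (hvar s t) (sq_nonneg _))
      _ = 1 / 32 := by field
  have hsup : ∫ ω, ⨆ t, ∑ s, (ramp δ (centeredSum Pr g (b s) ω t)
      - ∫ ω', ramp δ (centeredSum Pr g (b s) ω' t) ∂Pr) ∂Pr ≤ 1 / 32 * Fintype.card κ := by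
    refine (integral_iSup_sum_comp_centeredSum_sub_integral_le mg mh mσ hgint hh hlaw ig ih iσ hgh
      (lipschitzWith_ramp δ) hb).trans ?_
    rw [coe_nnnorm, Real.norm_of_nonneg (by positivity)]
    calc _ ≤ 4 * (2 / δ) * (δ * Fintype.card κ / 256) :=
          mul_le_mul_of_nonneg_left hrad (by positivity)
      _ = _ := by field
  have hcount : ∀ ω t, ((Finset.univ.filter fun s => centeredSum Pr g (b s) ω t ≤ -δ).card : ℝ)
      ≤ ∑ s, ramp δ (centeredSum Pr g (b s) ω t) := fun ω t => by
    rw [Finset.card_filter, Nat.cast_sum]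
    refine Finset.sum_le_sum fun s _ => ?_
    split_ifs with hs
    · exact_mod_cast one_le_ramp_of_le_neg hδ hs
    · exact_mod_cast (ramp_mem_Icc δ _).1
  have htail := measureReal_exists_sum_ge_le (ε := 1 / 24)
    (fun s => mramp.comp (measurable_centeredSum mg (b s)))
    ((iIndepFun_centeredSum mg ig hb).comp _ fun _ => mramp) (fun s ω t => ramp_mem_Icc δ _)
    hmean hsup (by norm_num)
  refine (measureReal_mono ?_).trans (htail.trans_eq (congrArg Real.exp (by ring)))
  rintro ω ⟨t, ht⟩
  refine ⟨t, le_trans ?_ (hcount ω t)⟩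
  linarith [(Nat.cast_nonneg (Fintype.card κ) : (0 : ℝ) ≤ _)]

end BlockDeviation

section Median

variable {S : ℕ} {v w : Fin S → ℝ} {u u' : ℝ}

lemma le_sort_of_lt_two_mul_card (h : S < 2 * (Finset.univ.filter fun s => u ≤ v s).card)
    {k : Fin S} (hk : S ≤ 2 * (k + 1)) : u ≤ v (Tuple.sort v k) := by
  by_contra! hlt
  have hsub : (Finset.univ.filter fun s => u ≤ v s) ⊆ (Finset.Ioi k).image (Tuple.sort v) := by
    intro s hs
    obtain ⟨j, rfl⟩ := (Tuple.sort v).surjective s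
    refine Finset.mem_image_of_mem _ (Finset.mem_Ioi.2 (lt_of_not_ge fun hj => ?_))
    exact (hlt.trans_le (Finset.mem_filter.1 hs).2).not_ge (Tuple.monotone_sort v hj)
  have hcard := (Finset.card_le_card hsub).trans Finset.card_image_le
  rw [Fin.card_Ioi] at hcard
  omega

lemma sort_le_of_lt_two_mul_card (h : S < 2 * (Finset.univ.filter fun s => v s ≤ u).card)
    {k : Fin S} (hk : 2 * (k : ℕ) ≤ S) : v (Tuple.sort v k) ≤ u := by
  by_contra! hlt
  have hsub : (Finset.univ.filter fun s => v s ≤ u) ⊆ (Finset.Iio k).image (Tuple.sort v) := by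
    intro s hs
    obtain ⟨j, rfl⟩ := (Tuple.sort v).surjective s
    refine Finset.mem_image_of_mem _ (Finset.mem_Iio.2 (lt_of_not_ge fun hj => ?_))
    exact ((Finset.mem_filter.1 hs).2.trans_lt hlt).not_ge (Tuple.monotone_sort v hj)
  have hcard := (Finset.card_le_card hsub).trans Finset.card_image_le
  rw [Fin.card_Iio] at hcard
  omega

/-- More than half of the numbers `v s` are at least `u`. -/
def MajorityGE (u : ℝ) (v : Fin S → ℝ) : Prop :=
  S < 2 * (Finset.univ.filter fun s => u ≤ v s).card

lemma MajorityGE.pos (h : MajorityGE u v) : 0 < S := by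
  have hle := Finset.card_filter_le (Finset.univ : Finset (Fin S)) fun s => u ≤ v s
  rw [Finset.card_fin] at hle
  unfold MajorityGE at h
  omega

lemma MajorityGE.imp (h : MajorityGE u v) (himp : ∀ s, u ≤ v s → u' ≤ w s) : MajorityGE u' w :=
  h.trans_le <| Nat.mul_le_mul_left 2 <| Finset.card_le_card <|
    Finset.monotone_filter_right _ fun s _ => himp s

lemma MajorityGE.mono (h : MajorityGE u v) (hu : u' ≤ u) : MajorityGE u' v :=
  h.imp fun _ => hu.trans

lemma MajorityGE.le_median (h : MajorityGE u v) : u ≤ median v := by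
  have hS := h.pos
  rw [median, dif_pos hS]
  have hlow := le_sort_of_lt_two_mul_card h (k := ⟨(S - 1) / 2, by omega⟩) (by simp only; omega)
  have hhigh := le_sort_of_lt_two_mul_card h (k := ⟨S / 2, by omega⟩) (by simp only; omega)
  linarith

lemma MajorityGE.median_neg_le (h : MajorityGE u v) : median (fun s => -v s) ≤ -u := by
  have hS := h.pos
  have hneg : S < 2 * (Finset.univ.filter fun s => -v s ≤ -u).card := by
    simpa only [neg_le_neg_iff, MajorityGE] using h
  rw [median, dif_pos hS]
  have hlow := sort_le_of_lt_two_mul_card hneg (k := ⟨(S - 1) / 2, by omega⟩)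
    (by simp only; omega)
  have hhigh := sort_le_of_lt_two_mul_card hneg (k := ⟨S / 2, by omega⟩) (by simp only; omega)
  linarith

end Median

section BlockMean

variable {𝒳 𝒴 : Type*} {N S : ℕ} {B : Fin S → Finset (Fin N)} {ℓ : ℝ → 𝒴 → ℝ} {x : Fin N → 𝒳}
  {y : Fin N → 𝒴} {fstar : 𝒳 → ℝ}

/-- The empirical excess risk of `f` on the block `B s`. -/
def blockMean (B : Fin S → Finset (Fin N)) (ℓ : ℝ → 𝒴 → ℝ) (x : Fin N → 𝒳) (y : Fin N → 𝒴)
    (fstar f : 𝒳 → ℝ) (s : Fin S) : ℝ :=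
  (1 / ((B s).card : ℝ)) * ∑ i ∈ B s, (ℓ (f (x i)) (y i) - ℓ (fstar (x i)) (y i))

lemma le_MOM_of_majorityGE {f : 𝒳 → ℝ} {u : ℝ} (h : MajorityGE u (blockMean B ℓ x y fstar f)) :
    u ≤ MOM B ℓ x y f fstar :=
  h.le_median

lemma MOM_le_neg_of_majorityGE {f : 𝒳 → ℝ} {u : ℝ}
    (h : MajorityGE u (blockMean B ℓ x y fstar f)) : MOM B ℓ x y fstar f ≤ -u := by
  refine le_of_eq_of_le ?_ h.median_neg_le
  unfold MOM blockMean
  congr 1 with s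
  rw [← mul_neg, ← Finset.sum_neg_distrib]
  simp only [neg_sub]

variable {F : Set (𝒳 → ℝ)} {L : ℝ} {g : 𝒳 → ℝ} {t : ℝ}

lemma blockMean_add_smul_sub_le (hℓ : IsLipschitzConvexLoss F ℓ L) (hfs : fstar ∈ F) (hg : g ∈ F)
    (ht₀ : 0 ≤ t) (ht₁ : t ≤ 1) (s : Fin S) :
    blockMean B ℓ x y fstar (fstar + t • (g - fstar)) s ≤ t * blockMean B ℓ x y fstar g s := by
  rw [blockMean, blockMean, mul_left_comm, Finset.mul_sum _ _ t]
  refine mul_le_mul_of_nonneg_left (Finset.sum_le_sum fun i _ => ?_) (by positivity)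
  have hconv := hℓ.convex t ht₀ ht₁ g hg fstar hfs (x i) (y i)
  have hval : (fstar + t • (g - fstar)) (x i) = t * g (x i) + (1 - t) * fstar (x i) := by
    simp only [Pi.add_apply, Pi.smul_apply, Pi.sub_apply, smul_eq_mul]
    ring
  rw [hval]
  linarith

lemma majorityGE_blockMean_of_segment (hℓ : IsLipschitzConvexLoss F ℓ L) (hfs : fstar ∈ F)
    (hg : g ∈ F) (ht₀ : 0 < t) (ht₁ : t ≤ 1) {u : ℝ}
    (h : MajorityGE (t * u) (blockMean B ℓ x y fstar (fstar + t • (g - fstar)))) :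
    MajorityGE u (blockMean B ℓ x y fstar g) :=
  h.imp fun s hs => le_of_mul_le_mul_left
    (hs.trans (blockMean_add_smul_sub_le hℓ hfs hg ht₀.le ht₁ s)) ht₀

end BlockMean

section Regularizer

variable {𝒳 : Type*} {E : Submodule ℝ (𝒳 → ℝ)} {F : Set (𝒳 → ℝ)} {φ : (𝒳 → ℝ) → ℝ} {η : ℝ}

lemma IsRegularizer.smul_le (hφ : IsRegularizer E F φ η) {h : 𝒳 → ℝ} (hh : h ∈ E) {t : ℝ}
    (ht₀ : 0 ≤ t) (ht₁ : t ≤ 1) : φ (t • h) ≤ t * φ h := by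
  have hconv := hφ.convex.2 (SetLike.mem_coe.2 hh) (SetLike.mem_coe.2 E.zero_mem) ht₀
    (sub_nonneg.2 ht₁) (add_sub_cancel t 1)
  simpa [hφ.zero] using hconv

-- `-g` need not lie in `F`; `f - g` is the midpoint of `f + f` and `-(g + g)` instead.
lemma IsRegularizer.sub_le (hφ : IsRegularizer E F φ η) (hFE : F ⊆ (E : Set (𝒳 → ℝ)))
    {f g : 𝒳 → ℝ} (hf : f ∈ F) (hg : g ∈ F) : φ (f - g) ≤ η * (φ f + φ g) := by
  have hff : f + f ∈ E := E.add_mem (hFE hf) (hFE hf)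
  have hgg : g + g ∈ E := E.add_mem (hFE hg) (hFE hg)
  have hmid : (1 / 2 : ℝ) • (f + f) + (1 / 2 : ℝ) • (-(g + g)) = f - g := by
    module
  have hconv := hφ.convex.2 (SetLike.mem_coe.2 hff) (SetLike.mem_coe.2 (E.neg_mem hgg))
    one_half_pos.le one_half_pos.le (add_halves (1 : ℝ))
  rw [hφ.even _ hgg, hmid] at hconv
  simp only [smul_eq_mul] at hconv
  linarith [hφ.quasi_add f hf f hf, hφ.quasi_add g hg g hg]

lemma rhoStar_pos {fstar : 𝒳 → ℝ} {A : ℝ} (hη : 0 < η) (hA : 0 < A) (hφs : 0 < φ fstar) :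
    0 < rhoStar φ fstar η A := by
  unfold rhoStar
  positivity

lemma IsRegularizer.mul_sub_le_mul_sub (hφ : IsRegularizer E F φ η)
    (hFE : F ⊆ (E : Set (𝒳 → ℝ))) {fstar g : 𝒳 → ℝ} (hfs : fstar ∈ F) (hg : g ∈ F)
    (hφs : 0 < φ fstar) {A lam : ℝ} (hA : 0 < A) (hlam : 0 ≤ lam) :
    φ (g - fstar) / rhoStar φ fstar η A * ((4 + 2 / A) * (lam * φ fstar)) - 2 * (lam * φ fstar)
      ≤ lam * (φ g - φ fstar) := by
  have hη := hφ.eta_pos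
  have hcancel : φ (g - fstar) / rhoStar φ fstar η A * ((4 + 2 / A) * (lam * φ fstar))
      = lam * (φ (g - fstar) / η) := by
    have : 4 + 2 / A ≠ 0 := by positivity
    rw [rhoStar]
    field
  have hsub : φ (g - fstar) / η ≤ φ g + φ fstar := by
    rw [div_le_iff₀' hη]
    exact hφ.sub_le hFE hg hfs
  rw [hcancel]
  linarith [mul_le_mul_of_nonneg_left hsub hlam]

end Regularizer

section MinmaxBounds

variable {𝒳 𝒴 : Type*} [MeasurableSpace 𝒳] [MeasurableSpace 𝒴] {N S : ℕ} {P : Measure (𝒳 × 𝒴)}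
  {E : Submodule ℝ (𝒳 → ℝ)} {F : Set (𝒳 → ℝ)} {ℓ : ℝ → 𝒴 → ℝ} {L : ℝ} {fstar : 𝒳 → ℝ}
  {φ : (𝒳 → ℝ) → ℝ} {η : ℝ} {B : Fin S → Finset (Fin N)} {x : Fin N → 𝒳} {y : Fin N → 𝒴}
  {A r ρ τ : ℝ} {g : 𝒳 → ℝ}

/-- The samples on which, simultaneously for all `f` in the localized class, the empirical excess
risk of `f` falls below its excess risk by more than `τ` on fewer than half of the blocks. -/
def IsGoodSample (P : Measure (𝒳 × 𝒴)) (ℓ : ℝ → 𝒴 → ℝ) (F : Set (𝒳 → ℝ)) (φ : (𝒳 → ℝ) → ℝ)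
    (fstar : 𝒳 → ℝ) (B : Fin S → Finset (Fin N)) (ρ r τ : ℝ) (x : Fin N → 𝒳) (y : Fin N → 𝒴) :
    Prop :=
  ∀ f ∈ localClass (P.map Prod.fst) F φ fstar ρ r,
    MajorityGE (excessRisk P ℓ fstar f - τ) (blockMean B ℓ x y fstar f)

lemma three_mul_two_mul_sq_div_lt (hA : 0 < A) {q : ℝ} (hq : r ^ 2 < q) :
    3 * (2 * r ^ 2 / (3 * A)) < 2 / A * q := by
  calc 3 * (2 * r ^ 2 / (3 * A)) = 2 / A * r ^ 2 := by field
    _ < 2 / A * q := mul_lt_mul_of_pos_left hq (by positivity)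

lemma ofReal_sq_rpow_one_half (hr : 0 ≤ r) :
    ENNReal.ofReal (r ^ 2) ^ (1 / 2 : ℝ) = ENNReal.ofReal r := by
  rw [ENNReal.ofReal_rpow_of_nonneg (sq_nonneg r) (by norm_num), ← Real.sqrt_eq_rpow,
    Real.sqrt_sq hr]

lemma eLpNorm_add_smul_sub_sub {μ : Measure 𝒳} (hg : MemLp (g - fstar) 2 μ) {t : ℝ} (ht : 0 ≤ t) :
    eLpNorm (fstar + t • (g - fstar) - fstar) 2 μ
      = ENNReal.ofReal (t * lpNorm (g - fstar) 2 μ) := by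
  rw [add_sub_cancel_left, eLpNorm_const_smul, Real.enorm_eq_ofReal ht, ENNReal.ofReal_mul ht,
    ofReal_lpNorm hg]

lemma add_smul_sub_mem_localClass {μ : Measure 𝒳} (hE : IsL2Space μ E)
    (hFE : F ⊆ (E : Set (𝒳 → ℝ))) (hF : Convex ℝ F) (hφ : IsRegularizer E F φ η)
    (hfs : fstar ∈ F) (hg : g ∈ F) {t : ℝ} (ht₀ : 0 ≤ t) (ht₁ : t ≤ 1)
    (hr : t * lpNorm (g - fstar) 2 μ ≤ r) (hρ : t * φ (g - fstar) ≤ ρ) :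
    fstar + t • (g - fstar) ∈ localClass μ F φ fstar ρ r := by
  have hgE : g - fstar ∈ E := E.sub_mem (hFE hg) (hFE hfs)
  refine ⟨hF.add_smul_sub_mem hfs hg ⟨ht₀, ht₁⟩, ?_, ?_⟩
  · rw [eLpNorm_add_smul_sub_sub (hE _ hgE).2 ht₀]
    exact ENNReal.ofReal_le_ofReal hr
  · rw [add_sub_cancel_left]
    exact (hφ.smul_le hgE ht₀ ht₁).trans hρ

lemma IsGoodSample.majorityGE_neg_mul
    (hE : IsL2Space (P.map Prod.fst) E) (hFE : F ⊆ (E : Set (𝒳 → ℝ))) (hF : Convex ℝ F)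
    (hℓ : IsLipschitzConvexLoss F ℓ L) (hfstar : IsOracle P ℓ F fstar) (hφ : IsRegularizer E F φ η)
    (hgood : IsGoodSample P ℓ F φ fstar B ρ r τ x y)
    (hg : g ∈ F) {m : ℝ} (hm : 1 ≤ m) (hr : lpNorm (g - fstar) 2 (P.map Prod.fst) ≤ r * m)
    (hρ : φ (g - fstar) ≤ ρ * m) : MajorityGE (-(τ * m)) (blockMean B ℓ x y fstar g) := by
  have hm₀ : 0 < m := one_pos.trans_le hm
  have ht₁ : m⁻¹ ≤ 1 := inv_le_one_of_one_le₀ hm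
  have hmem : fstar + m⁻¹ • (g - fstar) ∈ localClass (P.map Prod.fst) F φ fstar ρ r :=
    add_smul_sub_mem_localClass hE hFE hF hφ hfstar.1 hg (inv_nonneg.2 hm₀.le) ht₁
      ((inv_mul_le_iff₀' hm₀).2 hr) ((inv_mul_le_iff₀' hm₀).2 hρ)
  refine majorityGE_blockMean_of_segment hℓ hfstar.1 hg (inv_pos.2 hm₀) ht₁
    ((hgood _ hmem).mono ?_)
  have hrisk := hfstar.2 _ hmem.1
  rw [mul_neg, mul_left_comm, inv_mul_cancel₀ hm₀.ne', mul_one]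
  linarith

lemma IsGoodSample.majorityGE_mul_lpNorm
    (hE : IsL2Space (P.map Prod.fst) E) (hFE : F ⊆ (E : Set (𝒳 → ℝ))) (hF : Convex ℝ F)
    (hℓ : IsLipschitzConvexLoss F ℓ L) (hfstar : IsOracle P ℓ F fstar) (hφ : IsRegularizer E F φ η)
    (hgood : IsGoodSample P ℓ F φ fstar B ρ r (2 * r ^ 2 / (3 * A)) x y)
    (hBern : LocalBernstein P ℓ F φ fstar (ENNReal.ofReal (r ^ 2)) ρ A) (hA : 0 < A) (hr : 0 < r)
    (hg : g ∈ F) (hrg : r < lpNorm (g - fstar) 2 (P.map Prod.fst))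
    (hρ : r * φ (g - fstar) ≤ ρ * lpNorm (g - fstar) 2 (P.map Prod.fst)) :
    MajorityGE (lpNorm (g - fstar) 2 (P.map Prod.fst) * r / (3 * A))
      (blockMean B ℓ x y fstar g) := by
  set a := lpNorm (g - fstar) 2 (P.map Prod.fst)
  have ha : 0 < a := hr.trans hrg
  have ht₀ : 0 < r / a := by positivity
  have ht₁ : r / a ≤ 1 := (div_le_one ha).2 hrg.le
  have hφt : r / a * φ (g - fstar) ≤ ρ := by
    rw [div_mul_eq_mul_div]
    exact (div_le_iff₀ ha).2 hρ
  have hgL2 := (hE _ (E.sub_mem (hFE hg) (hFE hfstar.1))).2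
  have hmem := add_smul_sub_mem_localClass hE hFE hF hφ hfstar.1 hg ht₀.le ht₁
    (div_mul_cancel₀ r ha.ne').le hφt
  have hnorm : eLpNorm (fstar + (r / a) • (g - fstar) - fstar) 2 (P.map Prod.fst)
      = ENNReal.ofReal r := by
    rw [eLpNorm_add_smul_sub_sub hgL2 ht₀.le, div_mul_cancel₀ r ha.ne']
  have hrisk := hBern _ hmem.1 (hnorm.trans (ofReal_sq_rpow_one_half hr.le).symm) hmem.2.2
  rw [hnorm, ENNReal.toReal_ofReal hr.le, ← div_le_iff₀' hA] at hrisk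
  refine majorityGE_blockMean_of_segment hℓ hfstar.1 hg ht₀ ht₁ ((hgood _ hmem).mono ?_)
  have hval : r / a * (a * r / (3 * A)) = r ^ 2 / A - 2 * r ^ 2 / (3 * A) := by field
  linarith

lemma IsGoodSample.majorityGE_neg_mul_max
    (hE : IsL2Space (P.map Prod.fst) E) (hFE : F ⊆ (E : Set (𝒳 → ℝ))) (hF : Convex ℝ F)
    (hℓ : IsLipschitzConvexLoss F ℓ L) (hfstar : IsOracle P ℓ F fstar) (hφ : IsRegularizer E F φ η)
    (hgood : IsGoodSample P ℓ F φ fstar B ρ r (2 * r ^ 2 / (3 * A)) x y)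
    (hBern : LocalBernstein P ℓ F φ fstar (ENNReal.ofReal (r ^ 2)) ρ A) (hA : 0 < A) (hr : 0 < r)
    (hρ : 0 < ρ) (hg : g ∈ F) :
    MajorityGE (-(2 * r ^ 2 / (3 * A) * max 1 (φ (g - fstar) / ρ)))
      (blockMean B ℓ x y fstar g) := by
  have hφg : φ (g - fstar) ≤ ρ * max 1 (φ (g - fstar) / ρ) :=
    (div_le_iff₀' hρ).1 (le_max_right _ _)
  rcases le_or_gt (lpNorm (g - fstar) 2 (P.map Prod.fst)) (r * max 1 (φ (g - fstar) / ρ))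
    with hle | hlt
  · exact hgood.majorityGE_neg_mul hE hFE hF hℓ hfstar hφ hg (le_max_left _ _) hle hφg
  · have hrg : r < lpNorm (g - fstar) 2 (P.map Prod.fst) :=
      (le_mul_of_one_le_right hr.le (le_max_left _ _)).trans_lt hlt
    refine (hgood.majorityGE_mul_lpNorm hE hFE hF hℓ hfstar hφ hBern hA hr hg hrg ?_).mono ?_
    · calc r * φ (g - fstar) ≤ r * (ρ * max 1 (φ (g - fstar) / ρ)) :=
            mul_le_mul_of_nonneg_left hφg hr.le
        _ = ρ * (r * max 1 (φ (g - fstar) / ρ)) := mul_left_comm _ _ _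
        _ ≤ _ := mul_le_mul_of_nonneg_left hlt.le hρ.le
    · have hlower : 0 ≤ 2 * r ^ 2 / (3 * A) * max 1 (φ (g - fstar) / ρ) :=
        mul_nonneg (by positivity) (zero_le_one.trans (le_max_left _ _))
      have hupper : 0 ≤ lpNorm (g - fstar) 2 (P.map Prod.fst) * r / (3 * A) :=
        div_nonneg (mul_nonneg lpNorm_nonneg hr.le) (by positivity)
      linarith

variable {lam : ℝ} {fhat : 𝒳 → ℝ}

lemma IsGoodSample.minmaxObjective_oracle_le
    (hE : IsL2Space (P.map Prod.fst) E) (hFE : F ⊆ (E : Set (𝒳 → ℝ))) (hF : Convex ℝ F)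
    (hℓ : IsLipschitzConvexLoss F ℓ L) (hfstar : IsOracle P ℓ F fstar) (hφ : IsRegularizer E F φ η)
    (hgood : IsGoodSample P ℓ F φ fstar B (rhoStar φ fstar η A) r (2 * r ^ 2 / (3 * A)) x y)
    (hBern : LocalBernstein P ℓ F φ fstar (ENNReal.ofReal (r ^ 2)) (rhoStar φ fstar η A) A)
    (hA : 0 < A) (hr : 0 < r) (hφs : 0 < φ fstar) (hlam : r ^ 2 < lam * φ fstar) :
    minmaxObjective B ℓ F φ lam x y fstar
      ≤ ((2 * r ^ 2 / (3 * A) + lam * φ fstar : ℝ) : EReal) := by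
  refine iSup₂_le fun g hg => EReal.coe_le_coe_iff.2 ?_
  have hρ := rhoStar_pos hφ.eta_pos hA hφs
  have hlam₀ : 0 < lam := pos_of_mul_pos_left ((sq_nonneg r).trans_lt hlam) hφs.le
  have hMOM := MOM_le_neg_of_majorityGE
    (hgood.majorityGE_neg_mul_max hE hFE hF hℓ hfstar hφ hBern hA hr hρ hg)
  have hpen := hφ.mul_sub_le_mul_sub hFE hfstar.1 hg hφs hA hlam₀.le
  have hφg := mul_nonneg hlam₀.le (hφ.nonneg g (hFE hg))
  have hτ := three_mul_two_mul_sq_div_lt hA hlam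
  have hτ₀ : 0 ≤ 2 * r ^ 2 / (3 * A) := by positivity
  have hq : 0 < lam * φ fstar := (sq_nonneg r).trans_lt hlam
  rw [mul_sub] at hpen ⊢
  rcases le_total (φ (g - fstar) / rhoStar φ fstar η A) 1 with hw | hw
  · rw [max_eq_left hw] at hMOM
    linarith
  · rw [max_eq_right hw] at hMOM
    have hc : 0 ≤ (4 + 2 / A) * (lam * φ fstar) - 2 * r ^ 2 / (3 * A) := by linarith
    linarith [mul_le_mul_of_nonneg_right hw hc]

lemma IsGoodSample.MOM_add_le
    (hE : IsL2Space (P.map Prod.fst) E) (hFE : F ⊆ (E : Set (𝒳 → ℝ))) (hF : Convex ℝ F)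
    (hℓ : IsLipschitzConvexLoss F ℓ L) (hfstar : IsOracle P ℓ F fstar) (hφ : IsRegularizer E F φ η)
    (hmin : IsMinmaxMOM B ℓ F φ lam x y fhat)
    (hgood : IsGoodSample P ℓ F φ fstar B (rhoStar φ fstar η A) r (2 * r ^ 2 / (3 * A)) x y)
    (hBern : LocalBernstein P ℓ F φ fstar (ENNReal.ofReal (r ^ 2)) (rhoStar φ fstar η A) A)
    (hA : 0 < A) (hr : 0 < r) (hφs : 0 < φ fstar) (hlam : r ^ 2 < lam * φ fstar) :
    MOM B ℓ x y fhat fstar + lam * (φ fhat - φ fstar)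
      ≤ 2 * r ^ 2 / (3 * A) + lam * φ fstar := by
  refine EReal.coe_le_coe_iff.1 ?_
  calc _ ≤ minmaxObjective B ℓ F φ lam x y fhat :=
        le_iSup₂_of_le fstar hfstar.1 le_rfl
    _ ≤ minmaxObjective B ℓ F φ lam x y fstar := hmin.2 fstar hfstar.1
    _ ≤ _ := hgood.minmaxObjective_oracle_le hE hFE hF hℓ hfstar hφ hBern hA hr hφs hlam

lemma IsGoodSample.regularizer_sub_le
    (hE : IsL2Space (P.map Prod.fst) E) (hFE : F ⊆ (E : Set (𝒳 → ℝ))) (hF : Convex ℝ F)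
    (hℓ : IsLipschitzConvexLoss F ℓ L) (hfstar : IsOracle P ℓ F fstar) (hφ : IsRegularizer E F φ η)
    (hmin : IsMinmaxMOM B ℓ F φ lam x y fhat)
    (hgood : IsGoodSample P ℓ F φ fstar B (rhoStar φ fstar η A) r (2 * r ^ 2 / (3 * A)) x y)
    (hBern : LocalBernstein P ℓ F φ fstar (ENNReal.ofReal (r ^ 2)) (rhoStar φ fstar η A) A)
    (hA : 0 < A) (hr : 0 < r) (hφs : 0 < φ fstar) (hlam : r ^ 2 < lam * φ fstar) :
    φ (fhat - fstar) ≤ rhoStar φ fstar η A := by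
  have hρ := rhoStar_pos hφ.eta_pos hA hφs
  rw [← div_le_one hρ]
  by_contra! hw
  have hlam₀ : 0 < lam := pos_of_mul_pos_left ((sq_nonneg r).trans_lt hlam) hφs.le
  have hobj := hgood.MOM_add_le hE hFE hF hℓ hfstar hφ hmin hBern hA hr hφs hlam
  have hMOM := le_MOM_of_majorityGE
    (hgood.majorityGE_neg_mul_max hE hFE hF hℓ hfstar hφ hBern hA hr hρ hmin.1)
  have hpen := hφ.mul_sub_le_mul_sub hFE hfstar.1 hmin.1 hφs hA hlam₀.le
  have hτ := three_mul_two_mul_sq_div_lt hA hlam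
  have hτ₀ : 0 ≤ 2 * r ^ 2 / (3 * A) := by positivity
  have hc : 0 ≤ (4 + 2 / A) * (lam * φ fstar) - 2 * r ^ 2 / (3 * A) := by linarith [sq_nonneg r]
  rw [max_eq_right hw.le] at hMOM
  linarith [mul_le_mul_of_nonneg_right hw.le hc, sq_nonneg r]

lemma IsGoodSample.lpNorm_mul_le
    (hE : IsL2Space (P.map Prod.fst) E) (hFE : F ⊆ (E : Set (𝒳 → ℝ))) (hF : Convex ℝ F)
    (hℓ : IsLipschitzConvexLoss F ℓ L) (hfstar : IsOracle P ℓ F fstar) (hφ : IsRegularizer E F φ η)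
    (hmin : IsMinmaxMOM B ℓ F φ lam x y fhat)
    (hgood : IsGoodSample P ℓ F φ fstar B (rhoStar φ fstar η A) r (2 * r ^ 2 / (3 * A)) x y)
    (hBern : LocalBernstein P ℓ F φ fstar (ENNReal.ofReal (r ^ 2)) (rhoStar φ fstar η A) A)
    (hA : 0 < A) (hr : 0 < r) (hφs : 0 < φ fstar) (hlam : r ^ 2 < lam * φ fstar) :
    lpNorm (fhat - fstar) 2 (P.map Prod.fst) * r ≤ (4 + 6 * A) * lam * φ fstar := by
  have hlam₀ : 0 < lam := pos_of_mul_pos_left ((sq_nonneg r).trans_lt hlam) hφs.le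
  have hq : 0 < lam * φ fstar := by positivity
  have hAq : 0 < A * (lam * φ fstar) := by positivity
  rcases le_or_gt (lpNorm (fhat - fstar) 2 (P.map Prod.fst)) r with hle | hlt
  · linarith [mul_le_mul_of_nonneg_right hle hr.le, sq_nonneg r]
  have hobj := hgood.MOM_add_le hE hFE hF hℓ hfstar hφ hmin hBern hA hr hφs hlam
  have hφhat := hgood.regularizer_sub_le hE hFE hF hℓ hfstar hφ hmin hBern hA hr hφs hlam
  have hφnorm : r * φ (fhat - fstar)
      ≤ rhoStar φ fstar η A * lpNorm (fhat - fstar) 2 (P.map Prod.fst) := by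
    rw [mul_comm]
    exact mul_le_mul hφhat hlt.le hr.le (rhoStar_pos hφ.eta_pos hA hφs).le
  have hMOM := le_MOM_of_majorityGE
    (hgood.majorityGE_mul_lpNorm hE hFE hF hℓ hfstar hφ hBern hA hr hmin.1 hlt hφnorm)
  have hφpos := mul_nonneg hlam₀.le (hφ.nonneg fhat (hFE hmin.1))
  have hdiv : lpNorm (fhat - fstar) 2 (P.map Prod.fst) * r / (3 * A)
      ≤ 2 * r ^ 2 / (3 * A) + 2 * (lam * φ fstar) := by
    linarith
  have hA₃ : 0 < 3 * A := by positivity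
  rw [div_le_iff₀ hA₃, add_mul, div_mul_cancel₀ _ hA₃.ne'] at hdiv
  linarith

lemma IsGoodSample.eLpNorm_sub_le
    (hE : IsL2Space (P.map Prod.fst) E) (hFE : F ⊆ (E : Set (𝒳 → ℝ))) (hF : Convex ℝ F)
    (hℓ : IsLipschitzConvexLoss F ℓ L) (hfstar : IsOracle P ℓ F fstar) (hφ : IsRegularizer E F φ η)
    (hmin : IsMinmaxMOM B ℓ F φ lam x y fhat)
    (hgood : IsGoodSample P ℓ F φ fstar B (rhoStar φ fstar η A) r (2 * r ^ 2 / (3 * A)) x y)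
    (hBern : LocalBernstein P ℓ F φ fstar (ENNReal.ofReal (r ^ 2)) (rhoStar φ fstar η A) A)
    (hA : 0 < A) (hr : 0 < r) (hφs : 0 < φ fstar) (hlam : r ^ 2 < lam * φ fstar) :
    eLpNorm (fhat - fstar) 2 (P.map Prod.fst)
      ≤ ENNReal.ofReal ((4 + 6 * A) * lam * φ fstar) / ENNReal.ofReal (r ^ 2) ^ (1 / 2 : ℝ) := by
  rw [← ofReal_lpNorm (hE _ (E.sub_mem (hFE hmin.1) (hFE hfstar.1))).2,
    ofReal_sq_rpow_one_half hr.le, ← ENNReal.ofReal_div_of_pos hr]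
  exact ENNReal.ofReal_le_ofReal ((le_div_iff₀ hr).2
    (hgood.lpNorm_mul_le hE hFE hF hℓ hfstar hφ hmin hBern hA hr hφs hlam))

end MinmaxBounds

section Complexity

variable {Ω 𝒳 : Type*} [MeasurableSpace Ω] {N : ℕ} {Pr : Measure Ω} {X : Fin N → Ω → 𝒳}
  {fstar : 𝒳 → ℝ} {J : Finset (Fin N)}

lemma rademacherComplexity_mono {G G' : Set (𝒳 → ℝ)} (h : G ⊆ G') :
    rademacherComplexity Pr X fstar G J ≤ rademacherComplexity Pr X fstar G' J :=
  lintegral_mono fun _ => biSup_mono fun _ hf => h hf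

lemma rademacherComplexity_le_mul_of_segment {G G' : Set (𝒳 → ℝ)} {t : ℝ} (ht : 0 < t)
    (h : ∀ f ∈ G', fstar + t • (f - fstar) ∈ G) :
    rademacherComplexity Pr X fstar G' J
      ≤ ENNReal.ofReal t⁻¹ * rademacherComplexity Pr X fstar G J := by
  unfold rademacherComplexity
  rw [← lintegral_const_mul' _ _ ENNReal.ofReal_ne_top]
  refine lintegral_mono fun p => iSup₂_le fun f hf => ?_
  have hscale : ∑ i ∈ J, p.2 i * (f (X i p.1) - fstar (X i p.1))
      = t⁻¹ * ∑ i ∈ J, p.2 i * ((fstar + t • (f - fstar)) (X i p.1) - fstar (X i p.1)) := by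
    rw [Finset.mul_sum]
    refine Finset.sum_congr rfl fun i _ => ?_
    simp only [Pi.add_apply, Pi.smul_apply, Pi.sub_apply, smul_eq_mul, add_sub_cancel_left]
    field
  rw [hscale, abs_mul, abs_of_pos (inv_pos.2 ht), ENNReal.ofReal_mul (inv_nonneg.2 ht.le)]
  gcongr
  exact le_iSup₂_of_le _ (h f hf) le_rfl

variable [MeasurableSpace 𝒳] {μ : Measure 𝒳} {E : Submodule ℝ (𝒳 → ℝ)} {F : Set (𝒳 → ℝ)}
  {φ : (𝒳 → ℝ) → ℝ} {η ρ r r' : ℝ}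

lemma localClass_mono (h : r ≤ r') : localClass μ F φ fstar ρ r ⊆ localClass μ F φ fstar ρ r' :=
  fun _ hf => ⟨hf.1, hf.2.1.trans (ENNReal.ofReal_le_ofReal h), hf.2.2⟩

lemma lpNorm_sub_le_of_mem_localClass (hE : IsL2Space μ E) (hFE : F ⊆ (E : Set (𝒳 → ℝ)))
    (hfs : fstar ∈ F) (hr : 0 ≤ r) {f : 𝒳 → ℝ} (hf : f ∈ localClass μ F φ fstar ρ r) :
    lpNorm (f - fstar) 2 μ ≤ r := by
  rw [← ENNReal.ofReal_le_ofReal_iff hr,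
    ofReal_lpNorm (hE _ (E.sub_mem (hFE hf.1) (hFE hfs))).2]
  exact hf.2.1

lemma rademacherComplexity_localClass_le_mul (hE : IsL2Space μ E)
    (hFE : F ⊆ (E : Set (𝒳 → ℝ))) (hF : Convex ℝ F) (hφ : IsRegularizer E F φ η)
    (hfs : fstar ∈ F) (hr : 0 < r) (hrr' : r ≤ r') :
    rademacherComplexity Pr X fstar (localClass μ F φ fstar ρ r') J
      ≤ ENNReal.ofReal (r' / r)
        * rademacherComplexity Pr X fstar (localClass μ F φ fstar ρ r) J := by
  have hr' : 0 < r' := hr.trans_le hrr'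
  have ht₀ : 0 < r / r' := by positivity
  have ht₁ : r / r' ≤ 1 := (div_le_one hr').2 hrr'
  rw [← inv_div]
  refine rademacherComplexity_le_mul_of_segment ht₀ fun f hf => ?_
  refine add_smul_sub_mem_localClass hE hFE hF hφ hfs hf.1 ht₀.le ht₁ ?_ ?_
  · calc r / r' * lpNorm (f - fstar) 2 μ ≤ r / r' * r' := by
          gcongr
          exact lpNorm_sub_le_of_mem_localClass hE hFE hfs hr'.le hf
      _ = r := div_mul_cancel₀ r hr'.ne'
  · exact (mul_le_of_le_one_left (hφ.nonneg _ (E.sub_mem (hFE hf.1) (hFE hfs))) ht₁).trans hf.2.2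

variable {I : Finset (Fin N)} {L A : ℝ}

lemma rademacherComplexity_le_of_rTilde_lt (hE : IsL2Space μ E) (hFE : F ⊆ (E : Set (𝒳 → ℝ)))
    (hF : Convex ℝ F) (hφ : IsRegularizer E F φ η) (hfs : fstar ∈ F) (hL : 0 < L) (hA : 0 < A)
    (hr : 0 < r) (h : rTilde Pr μ F φ fstar X I η L A < ENNReal.ofReal r) (hJ : J ⊆ I)
    (hcard : (N : ℝ) / 2 ≤ J.card) :
    rademacherComplexity Pr X fstar (localClass μ F φ fstar (rhoStar φ fstar η A) r) J
      ≤ ENNReal.ofReal ((384 * A * L)⁻¹ * r ^ 2 * J.card) := by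
  obtain ⟨_, ⟨r₀, ⟨hr₀, hbound⟩, rfl⟩, hlt⟩ := sInf_lt_iff.1 h
  have hr₀r : r₀ < r := (ENNReal.ofReal_lt_ofReal_iff hr).1 hlt
  calc _ ≤ ENNReal.ofReal (r / r₀) * rademacherComplexity Pr X fstar
          (localClass μ F φ fstar (rhoStar φ fstar η A) r₀) J :=
        rademacherComplexity_localClass_le_mul hE hFE hF hφ hfs hr₀ hr₀r.le
    _ ≤ ENNReal.ofReal (r / r₀) * ENNReal.ofReal ((384 * A * L)⁻¹ * r₀ ^ 2 * J.card) := by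
        gcongr
        exact hbound J hJ hcard
    _ = ENNReal.ofReal ((384 * A * L)⁻¹ * (r * r₀) * J.card) := by
        rw [← ENNReal.ofReal_mul (by positivity)]
        congr 1
        field
    _ ≤ ENNReal.ofReal ((384 * A * L)⁻¹ * r ^ 2 * J.card) := by
        rw [sq r]
        gcongr

lemma rademacherComplexity_le_of_rTilde_le (hE : IsL2Space μ E) (hFE : F ⊆ (E : Set (𝒳 → ℝ)))
    (hF : Convex ℝ F) (hφ : IsRegularizer E F φ η) (hfs : fstar ∈ F) (hL : 0 < L) (hA : 0 < A)
    (hr : 0 < r) (h : rTilde Pr μ F φ fstar X I η L A ≤ ENNReal.ofReal r) (hJ : J ⊆ I)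
    (hcard : (N : ℝ) / 2 ≤ J.card) :
    rademacherComplexity Pr X fstar (localClass μ F φ fstar (rhoStar φ fstar η A) r) J
      ≤ ENNReal.ofReal ((384 * A * L)⁻¹ * r ^ 2 * J.card) := by
  have hcont : Continuous fun r' : ℝ => ENNReal.ofReal ((384 * A * L)⁻¹ * r' ^ 2 * J.card) :=
    ENNReal.continuous_ofReal.comp (by fun_prop)
  refine ge_of_tendsto (hcont.continuousWithinAt (s := Set.Ioi r))
    (eventually_nhdsWithin_of_forall fun r' hr' => ?_)
  have hr'₀ : 0 < r' := hr.trans hr'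
  exact (rademacherComplexity_mono (localClass_mono (le_of_lt hr'))).trans
    (rademacherComplexity_le_of_rTilde_lt hE hFE hF hφ hfs hL hA hr'₀
      (h.trans_lt ((ENNReal.ofReal_lt_ofReal_iff hr'₀).2 hr')) hJ hcard)

lemma exists_CSr_eq_ofReal_sq {S : ℕ} (hN : 0 < N) (hS : 0 < S) (hA : 0 < A) (hL : 0 < L)
    (htop : CSr Pr μ F φ fstar X I S η L A ≠ ∞) :
    ∃ r : ℝ, 0 < r ∧ CSr Pr μ F φ fstar X I S η L A = ENNReal.ofReal (r ^ 2) ∧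
      368 * A ^ 2 * L ^ 2 * ((S : ℝ) / N) ≤ r ^ 2 ∧
      rTilde Pr μ F φ fstar X I η L A ≤ ENNReal.ofReal r := by
  set C := CSr Pr μ F φ fstar X I S η L A
  have hlow : 368 * A ^ 2 * L ^ 2 * ((S : ℝ) / N) ≤ C.toReal :=
    (ENNReal.ofReal_le_iff_le_toReal htop).1 (le_max_right _ _)
  have hCpos : 0 < C.toReal := hlow.trans_lt' (by positivity)
  have hsq : Real.sqrt C.toReal ^ 2 = C.toReal := Real.sq_sqrt hCpos.le
  have hCsq : C = ENNReal.ofReal (Real.sqrt C.toReal ^ 2) := by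
    rw [hsq, ENNReal.ofReal_toReal htop]
  refine ⟨Real.sqrt C.toReal, Real.sqrt_pos.2 hCpos, hCsq, hsq.symm ▸ hlow, ?_⟩
  rw [← ENNReal.pow_le_pow_left_iff two_ne_zero, ← ENNReal.ofReal_pow (Real.sqrt_nonneg _), ← hCsq]
  exact le_max_left _ _

end Complexity

section L2Bounded

variable {Ω : Type*} [MeasurableSpace Ω] {μ : Measure Ω}

lemma integral_sq_le_of_eLpNorm_le {h : Ω → ℝ} (hm : AEStronglyMeasurable h μ) {r : ℝ} (hr : 0 ≤ r)
    (hle : eLpNorm h 2 μ ≤ ENNReal.ofReal r) : ∫ ω, h ω ^ 2 ∂μ ≤ r ^ 2 := by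
  have hL2 : MemLp h 2 μ := ⟨hm, hle.trans_lt ENNReal.ofReal_lt_top⟩
  rw [hL2.eLpNorm_eq_integral_rpow_norm two_ne_zero ENNReal.ofNat_ne_top,
    ENNReal.ofReal_le_ofReal_iff hr] at hle
  simp only [ENNReal.toReal_ofNat, Real.rpow_ofNat, Real.norm_eq_abs, sq_abs, ← one_div] at hle
  rwa [← Real.sqrt_eq_rpow, Real.sqrt_le_left hr] at hle

lemma abs_le_min_add_inv_mul_sq (x : ℝ) {M : ℝ} (hM : 0 < M) :
    |x| ≤ min |x| M + M⁻¹ * x ^ 2 := by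
  rcases le_total |x| M with hle | hge
  · rw [min_eq_left hle]
    exact le_add_of_nonneg_right (by positivity)
  · have hsq : |x| ≤ M⁻¹ * x ^ 2 := by
      rw [← sq_abs, inv_mul_eq_div, le_div_iff₀ hM, sq]
      exact mul_le_mul_of_nonneg_left hge (abs_nonneg x)
    exact hsq.trans (le_add_of_nonneg_left (le_min (abs_nonneg x) hM.le))

lemma norm_min_abs_le (x : ℝ) {M : ℝ} (hM : 0 ≤ M) : ‖min |x| M‖ ≤ M := by
  rw [Real.norm_of_nonneg (le_min (abs_nonneg x) hM)]
  exact min_le_right _ _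

variable [IsFiniteMeasure μ]

lemma abs_integral_le_integral_min_add {h : Ω → ℝ} (hL2 : MemLp h 2 μ) {M : ℝ} (hM : 0 < M) :
    |∫ ω, h ω ∂μ| ≤ ∫ ω, min |h ω| M ∂μ + M⁻¹ * ∫ ω, h ω ^ 2 ∂μ := by
  have hmin : Integrable (fun ω => min |h ω| M) μ :=
    ((hL2.integrable one_le_two).abs).inf (integrable_const M)
  have hsq : Integrable (fun ω => M⁻¹ * h ω ^ 2) μ := hL2.integrable_sq.const_mul _
  calc |∫ ω, h ω ∂μ| ≤ ∫ ω, |h ω| ∂μ := abs_integral_le_integral_abs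
    _ ≤ ∫ ω, (min |h ω| M + M⁻¹ * h ω ^ 2) ∂μ :=
        integral_mono (hL2.integrable one_le_two).abs (hmin.add hsq) fun ω =>
          abs_le_min_add_inv_mul_sq (h ω) hM
    _ = _ := by rw [integral_add hmin hsq, integral_const_mul]

lemma tendsto_integral_zero_of_integral_sq_le {h : ℕ → Ω → ℝ} {V : ℝ}
    (hL2 : ∀ n, MemLp (h n) 2 μ) (hV : ∀ n, ∫ ω, h n ω ^ 2 ∂μ ≤ V)
    (hlim : ∀ ω, Tendsto (fun n => h n ω) atTop (𝓝 0)) :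
    Tendsto (fun n => ∫ ω, h n ω ∂μ) atTop (𝓝 0) := by
  rw [Metric.tendsto_atTop]
  intro ε hε
  have hV₀ : 0 ≤ V := (integral_nonneg fun ω => sq_nonneg (h 0 ω)).trans (hV 0)
  obtain ⟨M, hM, hVM⟩ : ∃ M > 0, M⁻¹ * V < ε / 2 := by
    refine ⟨(2 * V + 1) / ε, by positivity, ?_⟩
    rw [inv_div, div_mul_eq_mul_div, div_lt_iff₀ (by positivity)]
    linarith [mul_comm ε V]
  have htrunc : Tendsto (fun n => ∫ ω, min |h n ω| M ∂μ) atTop (𝓝 0) := by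
    have hptwise : ∀ ω, Tendsto (fun n => min |h n ω| M) atTop (𝓝 0) := fun ω => by
      simpa [hM.le] using (hlim ω).abs.min (tendsto_const_nhds (x := M))
    simpa using tendsto_integral_of_dominated_convergence (fun _ => M)
      (fun n => (hL2 n).1.norm.inf aestronglyMeasurable_const) (integrable_const M)
      (fun n => ae_of_all _ fun ω => norm_min_abs_le (h n ω) hM.le) (ae_of_all _ hptwise)
  obtain ⟨n₀, hn₀⟩ := (htrunc.eventually_lt_const (half_pos hε)).exists_forall_of_atTop
  refine ⟨n₀, fun n hn => ?_⟩
  rw [dist_zero_right]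
  calc ‖∫ ω, h n ω ∂μ‖ ≤ ∫ ω, min |h n ω| M ∂μ + M⁻¹ * ∫ ω, h n ω ^ 2 ∂μ :=
        abs_integral_le_integral_min_add (hL2 n) hM
    _ ≤ ∫ ω, min |h n ω| M ∂μ + M⁻¹ * V := by
        gcongr
        exact hV n
    _ < ε := by linarith [hn₀ n hn]

end L2Bounded

section Loss

variable {𝒳 𝒴 : Type*} {F : Set (𝒳 → ℝ)} {ℓ : ℝ → 𝒴 → ℝ} {L : ℝ} {f g : 𝒳 → ℝ}

lemma IsLipschitzConvexLoss.tendsto_loss (hℓ : IsLipschitzConvexLoss F ℓ L) {u : ℕ → 𝒳 → ℝ}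
    (hu : ∀ n, u n ∈ F) (hf : f ∈ F) {x : 𝒳} (hlim : Tendsto (fun n => u n x) atTop (𝓝 (f x)))
    (y : 𝒴) : Tendsto (fun n => ℓ (u n x) y) atTop (𝓝 (ℓ (f x) y)) := by
  rw [tendsto_iff_norm_sub_tendsto_zero] at hlim ⊢
  refine squeeze_zero (fun n => norm_nonneg _) (fun n => hℓ.lipschitz _ (hu n) _ hf x y) ?_
  simpa only [mul_zero, Real.norm_eq_abs] using hlim.const_mul L

variable {Ω : Type*} [MeasurableSpace Ω] [MeasurableSpace 𝒳] [MeasurableSpace 𝒴]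
  {Pr : Measure Ω} {X : Ω → 𝒳} {Y : Ω → 𝒴}

lemma IsLipschitzConvexLoss.memLp_sub (hℓ : IsLipschitzConvexLoss F ℓ L)
    (hℓ_meas : ∀ f ∈ F, Measurable fun z : 𝒳 × 𝒴 => ℓ (f z.1) z.2) (hX : Measurable X)
    (hY : Measurable Y) (hf : f ∈ F) (hg : g ∈ F)
    (hfg : MemLp (fun ω => f (X ω) - g (X ω)) 2 Pr) :
    MemLp (fun ω => ℓ (f (X ω)) (Y ω) - ℓ (g (X ω)) (Y ω)) 2 Pr :=
  hfg.of_le_mul (((hℓ_meas f hf).sub (hℓ_meas g hg)).comp (hX.prodMk hY)).aestronglyMeasurable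
    (ae_of_all _ fun ω => hℓ.lipschitz f hf g hg (X ω) (Y ω))

lemma IsLipschitzConvexLoss.integral_sq_sub_le (hℓ : IsLipschitzConvexLoss F ℓ L)
    (hℓ_meas : ∀ f ∈ F, Measurable fun z : 𝒳 × 𝒴 => ℓ (f z.1) z.2) (hX : Measurable X)
    (hY : Measurable Y) (hf : f ∈ F) (hg : g ∈ F)
    (hfg : MemLp (fun ω => f (X ω) - g (X ω)) 2 Pr) {r : ℝ} (hr : 0 ≤ r)
    (hle : eLpNorm (fun ω => f (X ω) - g (X ω)) 2 Pr ≤ ENNReal.ofReal r) :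
    ∫ ω, (ℓ (f (X ω)) (Y ω) - ℓ (g (X ω)) (Y ω)) ^ 2 ∂Pr ≤ L ^ 2 * r ^ 2 := by
  have hL := hℓ.pos
  calc _ ≤ ∫ ω, L ^ 2 * (f (X ω) - g (X ω)) ^ 2 ∂Pr := by
        refine integral_mono (hℓ.memLp_sub hℓ_meas hX hY hf hg hfg).integrable_sq
          (hfg.integrable_sq.const_mul _) fun ω => ?_
        rw [← mul_pow, sq_le_sq, abs_mul, abs_of_pos hL]
        exact hℓ.lipschitz f hf g hg (X ω) (Y ω)
    _ = L ^ 2 * ∫ ω, (f (X ω) - g (X ω)) ^ 2 ∂Pr := integral_const_mul _ _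
    _ ≤ L ^ 2 * r ^ 2 := by
        gcongr
        exact integral_sq_le_of_eLpNorm_le hfg.1 hr hle

variable {P : Measure (𝒳 × 𝒴)} {E : Submodule ℝ (𝒳 → ℝ)} {fstar : 𝒳 → ℝ}
  {φ : (𝒳 → ℝ) → ℝ} {ρ r : ℝ}

lemma IsL2Space.memLp_fst (hE : IsL2Space (P.map Prod.fst) E) (hf : f ∈ E) (hg : g ∈ E) :
    MemLp (fun z : 𝒳 × 𝒴 => f z.1 - g z.1) 2 P :=
  (hE _ (E.sub_mem hf hg)).2.comp_measurePreserving ⟨measurable_fst, rfl⟩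

lemma eLpNorm_sub_fst_le_of_mem_localClass (hE : IsL2Space (P.map Prod.fst) E)
    (hFE : F ⊆ (E : Set (𝒳 → ℝ))) (hfs : fstar ∈ F) (hr : 0 ≤ r)
    (hf : f ∈ localClass (P.map Prod.fst) F φ fstar ρ r)
    (hg : g ∈ localClass (P.map Prod.fst) F φ fstar ρ r) :
    eLpNorm (fun z : 𝒳 × 𝒴 => f z.1 - g z.1) 2 P ≤ ENNReal.ofReal (2 * r) := by
  have hmeas : ∀ h ∈ F, AEStronglyMeasurable (h - fstar) (P.map Prod.fst) := fun h hh =>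
    (hE _ (E.sub_mem (hFE hh) (hFE hfs))).2.1
  calc _ = eLpNorm (f - g) 2 (P.map Prod.fst) :=
        eLpNorm_comp_measurePreserving (hE _ (E.sub_mem (hFE hf.1) (hFE hg.1))).2.1
          ⟨measurable_fst, rfl⟩
    _ = eLpNorm ((f - fstar) - (g - fstar)) 2 (P.map Prod.fst) := by
        rw [sub_sub_sub_cancel_right]
    _ ≤ eLpNorm (f - fstar) 2 (P.map Prod.fst) + eLpNorm (g - fstar) 2 (P.map Prod.fst) :=
        eLpNorm_sub_le (hmeas f hf.1) (hmeas g hg.1) one_le_two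
    _ ≤ ENNReal.ofReal (2 * r) := by
        rw [two_mul, ENNReal.ofReal_add hr hr]
        exact add_le_add hf.2.1 hg.2.1

lemma tendsto_excessRisk [IsFiniteMeasure P] (hE : IsL2Space (P.map Prod.fst) E)
    (hFE : F ⊆ (E : Set (𝒳 → ℝ))) (hℓ : IsLipschitzConvexLoss F ℓ L)
    (hℓ_meas : ∀ f ∈ F, Measurable fun z : 𝒳 × 𝒴 => ℓ (f z.1) z.2)
    (hfs : fstar ∈ F) (hr : 0 ≤ r) {u : ℕ → 𝒳 → ℝ}
    (hu : ∀ n, u n ∈ localClass (P.map Prod.fst) F φ fstar ρ r)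
    (hf : f ∈ localClass (P.map Prod.fst) F φ fstar ρ r)
    (hlim : ∀ x, Tendsto (fun n => u n x) atTop (𝓝 (f x))) :
    Tendsto (fun n => excessRisk P ℓ fstar (u n)) atTop (𝓝 (excessRisk P ℓ fstar f)) := by
  have hsub : ∀ g ∈ F, ∀ g' ∈ F, MemLp (fun z : 𝒳 × 𝒴 => g z.1 - g' z.1) 2 P :=
    fun g hg g' hg' => hE.memLp_fst (hFE hg) (hFE hg')
  have hloss : ∀ g ∈ F, ∀ g' ∈ F,
      MemLp (fun z : 𝒳 × 𝒴 => ℓ (g z.1) z.2 - ℓ (g' z.1) z.2) 2 P := fun g hg g' hg' =>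
    hℓ.memLp_sub hℓ_meas measurable_fst measurable_snd hg hg' (hsub g hg g' hg')
  have hzero : Tendsto (fun n => ∫ z, (ℓ (u n z.1) z.2 - ℓ (f z.1) z.2) ∂P) atTop (𝓝 0) := by
    refine tendsto_integral_zero_of_integral_sq_le (fun n => hloss _ (hu n).1 _ hf.1)
      (fun n => hℓ.integral_sq_sub_le hℓ_meas measurable_fst measurable_snd (hu n).1 hf.1
        (hsub _ (hu n).1 _ hf.1) (by positivity : 0 ≤ 2 * r)
        (eLpNorm_sub_fst_le_of_mem_localClass hE hFE hfs hr (hu n) hf)) fun z => ?_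
    rw [← sub_self (ℓ (f z.1) z.2)]
    exact (hℓ.tendsto_loss (fun n => (hu n).1) hf.1 (hlim z.1) z.2).sub_const _
  have hadd := hzero.add_const (excessRisk P ℓ fstar f)
  rw [zero_add] at hadd
  refine hadd.congr fun n => ?_
  rw [excessRisk, excessRisk, ← integral_add ((hloss _ (hu n).1 _ hf.1).integrable one_le_two)
    ((hloss _ hf.1 _ hfs).integrable one_le_two)]
  simp only [sub_add_sub_cancel]

end Loss

section Blocks

variable {N S : ℕ} {B : Fin S → Finset (Fin N)} {I : Finset (Fin N)}

lemma IsBlockPartition.pos (hB : IsBlockPartition B) (hN : 0 < N) : 0 < S := by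
  obtain ⟨s, -⟩ := hB.cover ⟨0, hN⟩
  exact s.pos

lemma IsBlockPartition.cast_card (hB : IsBlockPartition B) (s : Fin S) :
    ((B s).card : ℝ) = N / S := by
  rw [eq_div_iff (Nat.cast_pos.2 s.pos).ne']
  exact_mod_cast hB.card_eq s

/-- The blocks that contain informative data only. -/
def informativeBlocks (B : Fin S → Finset (Fin N)) (I : Finset (Fin N)) : Finset (Fin S) :=
  Finset.univ.filter fun s => B s ⊆ I

lemma mem_informativeBlocks {s : Fin S} : s ∈ informativeBlocks B I ↔ B s ⊆ I := by
  simp [informativeBlocks]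

lemma IsBlockPartition.card_compl_informativeBlocks_le (hB : IsBlockPartition B) :
    (informativeBlocks B I)ᶜ.card ≤ (Iᶜ).card := by
  refine (Finset.card_le_card_biUnion (f := fun s => B s ∩ Iᶜ)
    (fun s _ t _ hst => (hB.disjoint hst).mono Finset.inter_subset_left Finset.inter_subset_left)
    fun s hs => ?_).trans (Finset.card_le_card (Finset.biUnion_subset.2 fun s _ =>
      Finset.inter_subset_right))
  rw [Finset.mem_compl, mem_informativeBlocks, Finset.not_subset] at hs
  obtain ⟨i, hiB, hiI⟩ := hs
  exact ⟨i, Finset.mem_inter.2 ⟨hiB, Finset.mem_compl.2 hiI⟩⟩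

lemma IsBlockPartition.le_card_informativeBlocks (hB : IsBlockPartition B)
    (hS : 7 * ((Iᶜ).card : ℝ) / 3 ≤ S) : 4 / 7 * (S : ℝ) ≤ (informativeBlocks B I).card := by
  have hsplit := Finset.card_add_card_compl (informativeBlocks B I)
  have hle := hB.card_compl_informativeBlocks_le (I := I)
  rw [Fintype.card_fin] at hsplit
  have hcast : (S : ℝ) ≤ (informativeBlocks B I).card + (Iᶜ).card := by
    exact_mod_cast hsplit.symm.trans_le (Nat.add_le_add_left hle _)
  linarith

lemma biUnion_informativeBlocks_subset : (informativeBlocks B I).biUnion B ⊆ I :=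
  Finset.biUnion_subset.2 fun _ => mem_informativeBlocks.1

lemma IsBlockPartition.card_biUnion_informativeBlocks (hB : IsBlockPartition B) :
    (((informativeBlocks B I).biUnion B).card : ℝ) = (informativeBlocks B I).card * (N / S) := by
  rw [Finset.card_biUnion fun s _ t _ hst => hB.disjoint hst, Nat.cast_sum,
    Finset.sum_congr rfl fun s _ => hB.cast_card s, Finset.sum_const, nsmul_eq_mul]

lemma IsBlockPartition.half_le_card_biUnion_informativeBlocks (hB : IsBlockPartition B)
    (hN : 0 < N) (hS : 7 * ((Iᶜ).card : ℝ) / 3 ≤ S) :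
    (N : ℝ) / 2 ≤ ((informativeBlocks B I).biUnion B).card := by
  have hS₀ : (0 : ℝ) < S := Nat.cast_pos.2 (hB.pos hN)
  rw [hB.card_biUnion_informativeBlocks]
  calc (N : ℝ) / 2 = S / 2 * (N / S) := by field
    _ ≤ (informativeBlocks B I).card * (N / S) := by
        gcongr
        linarith [hB.le_card_informativeBlocks hS]

/-- The informative blocks, as sets of informative indices. -/
def restrictedBlock (B : Fin S → Finset (Fin N)) (I : Finset (Fin N))
    (s : informativeBlocks B I) : Finset I :=
  (B s).subtype (· ∈ I)

lemma IsBlockPartition.pairwise_disjoint_restrictedBlock (hB : IsBlockPartition B) :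
    Pairwise fun s t => Disjoint (restrictedBlock B I s) (restrictedBlock B I t) := by
  intro s t hst
  have hdisj := hB.disjoint (Subtype.coe_injective.ne hst)
  exact Finset.disjoint_left.2 fun i hs ht =>
    Finset.disjoint_left.1 hdisj (Finset.mem_subtype.1 hs) (Finset.mem_subtype.1 ht)

lemma sum_restrictedBlock {M : Type*} [AddCommMonoid M] (q : Fin N → M)
    (s : informativeBlocks B I) : ∑ i ∈ restrictedBlock B I s, q i = ∑ i ∈ B s, q i :=
  Finset.sum_subtype_of_mem q fun _ hi => mem_informativeBlocks.1 s.2 hi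

lemma IsBlockPartition.card_restrictedBlock (hB : IsBlockPartition B)
    (s : informativeBlocks B I) : ((restrictedBlock B I s).card : ℝ) = N / S := by
  rw [← hB.cast_card s]
  simpa only [Finset.sum_const, nsmul_eq_mul, mul_one] using
    sum_restrictedBlock (fun _ => (1 : ℝ)) s

lemma IsBlockPartition.sum_sum_restrictedBlock {M : Type*} [AddCommMonoid M]
    (hB : IsBlockPartition B) (q : Fin N → M) :
    ∑ s, ∑ i ∈ restrictedBlock B I s, q i = ∑ i ∈ (informativeBlocks B I).biUnion B, q i := by
  simp only [sum_restrictedBlock]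
  rw [Finset.sum_coe_sort (informativeBlocks B I) fun s => ∑ i ∈ B s, q i,
    Finset.sum_biUnion fun s _ t _ hst => hB.disjoint hst]

end Blocks

section RademacherSigns

lemma integral_le_of_lintegral_ofReal_le {Ω : Type*} [MeasurableSpace Ω] {μ : Measure Ω}
    {f : Ω → ℝ} {c : ℝ} (hc : 0 ≤ c)
    (h : ∫⁻ ω, ENNReal.ofReal (f ω) ∂μ ≤ ENNReal.ofReal c) : ∫ ω, f ω ∂μ ≤ c := by
  by_cases hf : Integrable f μ
  · rw [integral_eq_lintegral_pos_part_sub_lintegral_neg_part hf]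
    exact (sub_le_self _ ENNReal.toReal_nonneg).trans (ENNReal.toReal_le_of_le_ofReal hc h)
  · rwa [integral_undef hf]

lemma integral_iSup_sum_le_of_rademacherComplexity_le {Ω 𝒳 T : Type*} [MeasurableSpace Ω] {N : ℕ}
    {Pr : Measure Ω} {X : Fin N → Ω → 𝒳} {fstar : 𝒳 → ℝ} {J : Finset (Fin N)} {G : Set (𝒳 → ℝ)}
    [Finite T] [Nonempty T] {f : T → 𝒳 → ℝ} (hf : ∀ t, f t ∈ G) {c : ℝ} (hc : 0 ≤ c)
    (h : rademacherComplexity Pr X fstar G J ≤ ENNReal.ofReal c) :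
    ∫ p, ⨆ t, ∑ i ∈ J, p.2 i * (f t (X i p.1) - fstar (X i p.1))
      ∂(Pr.prod (Measure.pi fun _ : Fin N => rademacher)) ≤ c := by
  refine integral_le_of_lintegral_ofReal_le hc ((lintegral_mono fun p => ?_).trans h)
  obtain ⟨t, ht⟩ := exists_eq_ciSup_of_finite
    (f := fun t => ∑ i ∈ J, p.2 i * (f t (X i p.1) - fstar (X i p.1)))
  rw [← ht]
  exact (ENNReal.ofReal_le_ofReal (le_abs_self _)).trans
    (le_iSup₂_of_le (f t) (hf t) le_rfl)

lemma map_eval_pi_rademacher {N : ℕ} (i : Fin N) :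
    (Measure.pi fun _ : Fin N => rademacher).map (fun e => e i) = rademacher :=
  (measurePreserving_eval (fun _ : Fin N => rademacher) i).map_eq

lemma iIndepFun_eval_pi_rademacher {N : ℕ} (I : Finset (Fin N)) :
    iIndepFun (fun (i : I) (e : Fin N → ℝ) => e i) (Measure.pi fun _ : Fin N => rademacher) :=
  (iIndepFun_pi (μ := fun _ : Fin N => rademacher) (X := fun _ x => x)
    fun _ => aemeasurable_id).precomp (g := ((↑) : I → Fin N)) Subtype.val_injective

end RademacherSigns

section InformativeData

variable {Ω 𝒳 𝒴 : Type*} [MeasurableSpace Ω] [MeasurableSpace 𝒳] [MeasurableSpace 𝒴] {N : ℕ}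
  {Pr : Measure Ω} {P : Measure (𝒳 × 𝒴)} {E : Submodule ℝ (𝒳 → ℝ)} {F : Set (𝒳 → ℝ)}
  {ℓ : ℝ → 𝒴 → ℝ} {L : ℝ} {fstar f : 𝒳 → ℝ} {φ : (𝒳 → ℝ) → ℝ} {ρ r : ℝ} {X : Fin N → Ω → 𝒳}
  {Y : Fin N → Ω → 𝒴} {I : Finset (Fin N)} {i : Fin N}

lemma IsInformative.memLp_sub (hI : IsInformative Pr P ℓ F fstar X Y I)
    (hE : IsL2Space (P.map Prod.fst) E) (hFE : F ⊆ (E : Set (𝒳 → ℝ))) (hfs : fstar ∈ F)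
    (hi : i ∈ I) (hf : f ∈ F) : MemLp (fun ω => f (X i ω) - fstar (X i ω)) 2 Pr := by
  have hsub := hE _ (E.sub_mem (hFE hf) (hFE hfs))
  refine ⟨(hsub.1.comp (hI.measurable_X i hi)).aestronglyMeasurable, ?_⟩
  rw [hI.same_L2 i hi f hf]
  exact hsub.2.2

lemma IsInformative.integral_loss_sub (hI : IsInformative Pr P ℓ F fstar X Y I)
    (hℓ_meas : ∀ f ∈ F, Measurable fun z : 𝒳 × 𝒴 => ℓ (f z.1) z.2) (hfs : fstar ∈ F)
    (hi : i ∈ I) (hf : f ∈ F) :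
    ∫ ω, (ℓ (f (X i ω)) (Y i ω) - ℓ (fstar (X i ω)) (Y i ω)) ∂Pr = excessRisk P ℓ fstar f := by
  rw [← hI.same_excessRisk i hi f hf, excessRisk]
  exact (integral_map ((hI.measurable_X i hi).prodMk (hI.measurable_Y i hi)).aemeasurable
    ((hℓ_meas f hf).sub (hℓ_meas fstar hfs)).aestronglyMeasurable).symm

lemma IsInformative.variance_loss_sub_le [IsProbabilityMeasure Pr]
    (hI : IsInformative Pr P ℓ F fstar X Y I)
    (hE : IsL2Space (P.map Prod.fst) E) (hFE : F ⊆ (E : Set (𝒳 → ℝ)))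
    (hℓ : IsLipschitzConvexLoss F ℓ L)
    (hℓ_meas : ∀ f ∈ F, Measurable fun z : 𝒳 × 𝒴 => ℓ (f z.1) z.2) (hfs : fstar ∈ F)
    (hi : i ∈ I) (hr : 0 ≤ r) (hf : f ∈ localClass (P.map Prod.fst) F φ fstar ρ r) :
    variance (fun ω => ℓ (f (X i ω)) (Y i ω) - ℓ (fstar (X i ω)) (Y i ω)) Pr ≤ L ^ 2 * r ^ 2 := by
  have hX := hI.measurable_X i hi
  have hY := hI.measurable_Y i hi
  have hsub := hI.memLp_sub hE hFE hfs hi hf.1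
  exact (variance_le_expectation_sq (hℓ.memLp_sub hℓ_meas hX hY hf.1 hfs hsub).1).trans
    (hℓ.integral_sq_sub_le hℓ_meas hX hY hf.1 hfs hsub hr
      ((hI.same_L2 i hi f hf.1).trans_le hf.2.1))

end InformativeData

section BadEvent

variable {Ω 𝒳 𝒴 T : Type*} {N S : ℕ} {F : Set (𝒳 → ℝ)} {ℓ : ℝ → 𝒴 → ℝ} {L : ℝ} {fstar : 𝒳 → ℝ}
  {f : T → 𝒳 → ℝ} {r A : ℝ} {X : Fin N → Ω → 𝒳} {Y : Fin N → Ω → 𝒴} {I : Finset (Fin N)}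
  {B : Fin S → Finset (Fin N)}

/-- The excess losses of the functions `f t` at the informative data, as random vectors. -/
def excessLoss (ℓ : ℝ → 𝒴 → ℝ) (fstar : 𝒳 → ℝ) (f : T → 𝒳 → ℝ) (X : Fin N → Ω → 𝒳)
    (Y : Fin N → Ω → 𝒴) (I : Finset (Fin N)) (i : I) (ω : Ω) (t : T) : ℝ :=
  ℓ (f t (X i ω)) (Y i ω) - ℓ (fstar (X i ω)) (Y i ω)

/-- The deviations of the functions `f t` from `fstar` at the informative data, as random vectors,
scaled by the Lipschitz constant so that they dominate the increments of `excessLoss`. -/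
def scaledDeviation (L : ℝ) (fstar : 𝒳 → ℝ) (f : T → 𝒳 → ℝ) (X : Fin N → Ω → 𝒳)
    (I : Finset (Fin N)) (i : I) (ω : Ω) (t : T) : ℝ :=
  L * (f t (X i ω) - fstar (X i ω))

lemma abs_excessLoss_sub_le (hℓ : IsLipschitzConvexLoss F ℓ L) (hf : ∀ t, f t ∈ F) (i : I)
    (ω : Ω) (s t : T) :
    |excessLoss ℓ fstar f X Y I i ω s - excessLoss ℓ fstar f X Y I i ω t|
      ≤ |scaledDeviation L fstar f X I i ω s - scaledDeviation L fstar f X I i ω t| := by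
  simp only [excessLoss, scaledDeviation, sub_sub_sub_cancel_right, ← mul_sub, abs_mul,
    abs_of_pos hℓ.pos]
  exact hℓ.lipschitz _ (hf s) _ (hf t) (X i ω) (Y i ω)

variable [MeasurableSpace Ω] {Pr : Measure Ω}

lemma integral_iSup_scaledDeviation_le [Finite T] [Nonempty T] (hB : IsBlockPartition B)
    (hN : 0 < N) (hL : 0 < L) (hA : 0 < A) {G : Set (𝒳 → ℝ)} (hf : ∀ t, f t ∈ G)
    (hcomp : rademacherComplexity Pr X fstar G ((informativeBlocks B I).biUnion B)
      ≤ ENNReal.ofReal ((384 * A * L)⁻¹ * r ^ 2 * ((informativeBlocks B I).biUnion B).card)) :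
    ∫ p, ⨆ t, ∑ s, ∑ i ∈ restrictedBlock B I s, p.2 i * scaledDeviation L fstar f X I i p.1 t
        ∂(Pr.prod (Measure.pi fun _ : Fin N => rademacher))
      ≤ N / S * (2 * r ^ 2 / (3 * A)) * Fintype.card (informativeBlocks B I) / 256 := by
  have hS : (0 : ℝ) < S := Nat.cast_pos.2 (hB.pos hN)
  have hscale : ∀ (p : Ω × (Fin N → ℝ)) t,
      ∑ s, ∑ i ∈ restrictedBlock B I s, p.2 i * scaledDeviation L fstar f X I i p.1 t
        = L * ∑ i ∈ (informativeBlocks B I).biUnion B,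
          p.2 i * (f t (X i p.1) - fstar (X i p.1)) := fun p t => by
    simp only [scaledDeviation, mul_left_comm _ L, ← Finset.mul_sum]
    rw [hB.sum_sum_restrictedBlock fun i => p.2 i * (f t (X i p.1) - fstar (X i p.1))]
  simp only [hscale, ← Real.mul_iSup_of_nonneg hL.le, integral_const_mul]
  calc _ ≤ L * ((384 * A * L)⁻¹ * r ^ 2 * ((informativeBlocks B I).biUnion B).card) := by
        gcongr
        exact integral_iSup_sum_le_of_rademacherComplexity_le hf (by positivity) hcomp
    _ = _ := by
        rw [hB.card_biUnion_informativeBlocks, Fintype.card_coe]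
        field

variable [MeasurableSpace 𝒳] [MeasurableSpace 𝒴] {P : Measure (𝒳 × 𝒴)}
  {E : Submodule ℝ (𝒳 → ℝ)} {φ : (𝒳 → ℝ) → ℝ} {ρ : ℝ}

lemma measurable_pi_loss_sub (hℓ_meas : ∀ f ∈ F, Measurable fun z : 𝒳 × 𝒴 => ℓ (f z.1) z.2)
    (hfs : fstar ∈ F) (hf : ∀ t, f t ∈ F) :
    Measurable fun (z : 𝒳 × 𝒴) t => ℓ (f t z.1) z.2 - ℓ (fstar z.1) z.2 :=
  measurable_pi_lambda _ fun t => (hℓ_meas _ (hf t)).sub (hℓ_meas _ hfs)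

lemma measurable_pi_mul_sub (hf_meas : ∀ f ∈ F, Measurable f) (hfs : fstar ∈ F)
    (hf : ∀ t, f t ∈ F) :
    Measurable fun (z : 𝒳 × 𝒴) t => L * (f t z.1 - fstar z.1) :=
  measurable_pi_lambda _ fun t =>
    (((hf_meas _ (hf t)).sub (hf_meas _ hfs)).comp measurable_fst).const_mul L

/-- The event that at least one eighth of the informative blocks underestimate the excess risk of
`f` by `τ`. -/
def badEvent (P : Measure (𝒳 × 𝒴)) (ℓ : ℝ → 𝒴 → ℝ) (X : Fin N → Ω → 𝒳) (Y : Fin N → Ω → 𝒴)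
    (I : Finset (Fin N)) (B : Fin S → Finset (Fin N)) (fstar : 𝒳 → ℝ) (τ : ℝ) (f : 𝒳 → ℝ) :
    Set Ω :=
  {ω | ((informativeBlocks B I).card : ℝ) / 8 ≤ ((informativeBlocks B I).filter fun s =>
    blockMean B ℓ (fun i => X i ω) (fun i => Y i ω) fstar f s
      ≤ excessRisk P ℓ fstar f - τ).card}

lemma centeredSum_excessLoss (hI : IsInformative Pr P ℓ F fstar X Y I)
    (hℓ_meas : ∀ f ∈ F, Measurable fun z : 𝒳 × 𝒴 => ℓ (f z.1) z.2) (hfs : fstar ∈ F)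
    (hB : IsBlockPartition B) (hN : 0 < N) {t : T} (hf : f t ∈ F) (s : informativeBlocks B I)
    (ω : Ω) :
    centeredSum Pr (excessLoss ℓ fstar f X Y I) (restrictedBlock B I s) ω t
      = N / S * (blockMean B ℓ (fun i => X i ω) (fun i => Y i ω) fstar (f t) s
        - excessRisk P ℓ fstar (f t)) := by
  have hmean : ∀ i : I, ∫ ω', excessLoss ℓ fstar f X Y I i ω' t ∂Pr = excessRisk P ℓ fstar (f t) :=
    fun i => hI.integral_loss_sub hℓ_meas hfs i.2 hf
  have hS : (0 : ℝ) < S := Nat.cast_pos.2 (hB.pos hN)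
  have hsum : ∑ i ∈ restrictedBlock B I s, excessLoss ℓ fstar f X Y I i ω t
      = N / S * blockMean B ℓ (fun i => X i ω) (fun i => Y i ω) fstar (f t) s := by
    rw [blockMean, hB.cast_card, ← mul_assoc, mul_one_div_cancel (by positivity), one_mul]
    exact sum_restrictedBlock
      (fun i => ℓ (f t (X i ω)) (Y i ω) - ℓ (fstar (X i ω)) (Y i ω)) s
  simp only [centeredSum_apply, hmean]
  rw [Finset.sum_sub_distrib, hsum, Finset.sum_const, nsmul_eq_mul, hB.card_restrictedBlock,
    mul_sub]

lemma mem_badEvent_iff_centeredSum (hI : IsInformative Pr P ℓ F fstar X Y I)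
    (hℓ_meas : ∀ f ∈ F, Measurable fun z : 𝒳 × 𝒴 => ℓ (f z.1) z.2) (hfs : fstar ∈ F)
    (hB : IsBlockPartition B) (hN : 0 < N) {t : T} (hf : f t ∈ F) {τ : ℝ} {ω : Ω} :
    ω ∈ badEvent P ℓ X Y I B fstar τ (f t) ↔
      (Fintype.card (informativeBlocks B I) : ℝ) / 8 ≤ (Finset.univ.filter fun s =>
        centeredSum Pr (excessLoss ℓ fstar f X Y I) (restrictedBlock B I s) ω t
          ≤ -(N / S * τ)).card := by
  have hS : (0 : ℝ) < S := Nat.cast_pos.2 (hB.pos hN)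
  have hN' : (0 : ℝ) < N := Nat.cast_pos.2 hN
  simp only [centeredSum_excessLoss hI hℓ_meas hfs hB hN hf, ← mul_neg,
    mul_le_mul_iff_right₀ (div_pos hN' hS), sub_le_iff_le_add', ← sub_eq_add_neg]
  rw [Finset.univ_eq_attach, Finset.filter_attach fun s => blockMean B ℓ (fun i => X i ω)
    (fun i => Y i ω) fstar (f t) s ≤ excessRisk P ℓ fstar (f t) - τ, Finset.card_map,
    Finset.card_attach, Fintype.card_coe]
  rfl

lemma mul_le_sq_div_of_le {n : ℝ} (hn : 0 < n) (hA : 0 < A) (h : 368 * A ^ 2 * L ^ 2 ≤ r ^ 2 * n) :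
    n * (L ^ 2 * r ^ 2) ≤ (n * (2 * r ^ 2 / (3 * A))) ^ 2 / 32 := by
  calc n * (L ^ 2 * r ^ 2) = 368 * A ^ 2 * L ^ 2 * (n * r ^ 2 / (368 * A ^ 2)) := by field
    _ ≤ r ^ 2 * n * (n * r ^ 2 / (368 * A ^ 2)) := by gcongr
    _ ≤ r ^ 2 * n * (n * r ^ 2 / (72 * A ^ 2)) := by gcongr; norm_num
    _ = (n * (2 * r ^ 2 / (3 * A))) ^ 2 / 32 := by field

lemma sum_variance_excessLoss_le [IsProbabilityMeasure Pr]
    (hI : IsInformative Pr P ℓ F fstar X Y I)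
    (hE : IsL2Space (P.map Prod.fst) E) (hFE : F ⊆ (E : Set (𝒳 → ℝ)))
    (hℓ : IsLipschitzConvexLoss F ℓ L)
    (hℓ_meas : ∀ f ∈ F, Measurable fun z : 𝒳 × 𝒴 => ℓ (f z.1) z.2) (hfs : fstar ∈ F)
    (hB : IsBlockPartition B) (hN : 0 < N) (hA : 0 < A) (hr : 0 ≤ r)
    (hlow : 368 * A ^ 2 * L ^ 2 * ((S : ℝ) / N) ≤ r ^ 2) {t : T}
    (hf : f t ∈ localClass (P.map Prod.fst) F φ fstar ρ r) (s : informativeBlocks B I) :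
    ∑ i ∈ restrictedBlock B I s, variance (fun ω => excessLoss ℓ fstar f X Y I i ω t) Pr
      ≤ (N / S * (2 * r ^ 2 / (3 * A))) ^ 2 / 32 := by
  have hS : (0 : ℝ) < S := Nat.cast_pos.2 (hB.pos hN)
  calc _ ≤ ∑ _i ∈ restrictedBlock B I s, L ^ 2 * r ^ 2 := Finset.sum_le_sum fun i _ =>
        hI.variance_loss_sub_le hE hFE hℓ hℓ_meas hfs i.2 hr hf
    _ = N / S * (L ^ 2 * r ^ 2) := by
        rw [Finset.sum_const, nsmul_eq_mul, hB.card_restrictedBlock]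
    _ ≤ _ := by
        refine mul_le_sq_div_of_le (by positivity) hA ?_
        rwa [← div_le_iff₀ (by positivity), div_eq_mul_inv, inv_div]

variable [IsProbabilityMeasure Pr]

theorem measureReal_exists_mem_badEvent_le [Finite T] [Nonempty T]
    (hI : IsInformative Pr P ℓ F fstar X Y I)
    (hE : IsL2Space (P.map Prod.fst) E) (hFE : F ⊆ (E : Set (𝒳 → ℝ)))
    (hℓ : IsLipschitzConvexLoss F ℓ L)
    (hℓ_meas : ∀ f ∈ F, Measurable fun z : 𝒳 × 𝒴 => ℓ (f z.1) z.2) (hfs : fstar ∈ F)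
    (hB : IsBlockPartition B) (hN : 0 < N) (hS : 7 * ((Iᶜ).card : ℝ) / 3 ≤ S)
    (hA : 0 < A) (hr : 0 < r) (hlow : 368 * A ^ 2 * L ^ 2 * ((S : ℝ) / N) ≤ r ^ 2)
    (hcomp : ∀ J ⊆ I, (N : ℝ) / 2 ≤ J.card →
      rademacherComplexity Pr X fstar (localClass (P.map Prod.fst) F φ fstar ρ r) J
        ≤ ENNReal.ofReal ((384 * A * L)⁻¹ * r ^ 2 * J.card))
    (hf : ∀ t, f t ∈ localClass (P.map Prod.fst) F φ fstar ρ r) :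
    Pr.real {ω | ∃ t, ω ∈ badEvent P ℓ X Y I B fstar (2 * r ^ 2 / (3 * A)) (f t)}
      ≤ Real.exp (-(S : ℝ) / 504) := by
  have := Fintype.ofFinite T
  have hS₀ : (0 : ℝ) < S := Nat.cast_pos.2 (hB.pos hN)
  have hfF : ∀ t, f t ∈ F := fun t => (hf t).1
  have hloss := measurable_pi_loss_sub hℓ_meas hfs hfF
  have hdev := measurable_pi_mul_sub (L := L) (𝒴 := 𝒴) (fun f hf => (hE f (hFE hf)).1) hfs hfF
  have hdata : ∀ i : I, Measurable fun ω => (X i ω, Y i ω) := fun i =>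
    (hI.measurable_X i i.2).prodMk (hI.measurable_Y i i.2)
  have hsub : ∀ (i : I) t, MemLp (fun ω => f t (X i ω) - fstar (X i ω)) 2 Pr := fun i t =>
    hI.memLp_sub hE hFE hfs i.2 (hfF t)
  simp only [mem_badEvent_iff_centeredSum hI hℓ_meas hfs hB hN (hfF _)]
  refine (measureReal_exists_card_centeredSum_le_le (fun i => hloss.comp (hdata i))
    (h := scaledDeviation L fstar f X I) (fun i => hdev.comp (hdata i))
    (fun i => measurable_pi_apply (i : Fin N))
    (fun i t => hℓ.memLp_sub hℓ_meas (hI.measurable_X i i.2) (hI.measurable_Y i i.2) (hfF t) hfs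
      (hsub i t))
    (fun i => Integrable.of_eval fun t => ((hsub i t).integrable one_le_two).const_mul L)
    (fun i => map_eval_pi_rademacher (i : Fin N)) (hI.indep.comp _ fun _ => hloss)
    (hI.indep.comp _ fun _ => hdev) (iIndepFun_eval_pi_rademacher I)
    (abs_excessLoss_sub_le hℓ hfF) hB.pairwise_disjoint_restrictedBlock (by positivity)
    (fun s t => sum_variance_excessLoss_le hI hE hFE hℓ hℓ_meas hfs hB hN hA hr.le hlow (hf t) s)
    (integral_iSup_scaledDeviation_le hB hN hℓ.pos hA hf (hcomp _ biUnion_informativeBlocks_subset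
      (hB.half_le_card_biUnion_informativeBlocks hN hS)))).trans ?_
  rw [Fintype.card_coe, Real.exp_le_exp]
  linarith [hB.le_card_informativeBlocks hS]

end BadEvent

section GoodEvent

lemma majorityGE_of_card_filter_lt {S : ℕ} {K : Finset (Fin S)} {u : ℝ} {v : Fin S → ℝ}
    (hK : 4 / 7 * (S : ℝ) ≤ K.card) (h : ((K.filter fun s => v s < u).card : ℝ) < K.card / 8) :
    MajorityGE u v := by
  have hsplit : ((K.filter fun s => v s < u).card : ℝ) + (K.filter fun s => ¬ v s < u).card
      = K.card := by
    exact_mod_cast Finset.card_filter_add_card_filter_not (s := K) fun s => v s < u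
  have hle : ((K.filter fun s => ¬ v s < u).card : ℝ)
      ≤ (Finset.univ.filter fun s => u ≤ v s).card := by
    simp only [not_lt]
    exact_mod_cast Finset.card_le_card (Finset.filter_subset_filter _ (Finset.subset_univ K))
  rw [MajorityGE, ← Nat.cast_lt (α := ℝ), Nat.cast_mul, Nat.cast_two]
  linarith

lemma tendsto_blockMean {𝒳 𝒴 : Type*} {N S : ℕ} {F : Set (𝒳 → ℝ)} {ℓ : ℝ → 𝒴 → ℝ} {L : ℝ}
    (hℓ : IsLipschitzConvexLoss F ℓ L) {u : ℕ → 𝒳 → ℝ} {f : 𝒳 → ℝ} (hu : ∀ n, u n ∈ F)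
    (hf : f ∈ F) (hlim : ∀ x, Tendsto (fun n => u n x) atTop (𝓝 (f x)))
    (B : Fin S → Finset (Fin N)) (x : Fin N → 𝒳) (y : Fin N → 𝒴) (fstar : 𝒳 → ℝ) (s : Fin S) :
    Tendsto (fun n => blockMean B ℓ x y fstar (u n) s) atTop (𝓝 (blockMean B ℓ x y fstar f s)) :=
  (tendsto_finsetSum _ fun i _ =>
    (hℓ.tendsto_loss hu hf (hlim (x i)) (y i)).sub_const _).const_mul _

variable {Ω 𝒳 𝒴 : Type*} [MeasurableSpace 𝒳] [MeasurableSpace 𝒴] {N S : ℕ}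
  {P : Measure (𝒳 × 𝒴)} {E : Submodule ℝ (𝒳 → ℝ)} {F : Set (𝒳 → ℝ)} {ℓ : ℝ → 𝒴 → ℝ} {L : ℝ}
  {fstar f : 𝒳 → ℝ} {φ : (𝒳 → ℝ) → ℝ} {ρ r A : ℝ} {X : Fin N → Ω → 𝒳} {Y : Fin N → Ω → 𝒴}
  {I : Finset (Fin N)} {B : Fin S → Finset (Fin N)}

lemma majorityGE_of_forall_notMem_badEvent [IsFiniteMeasure P]
    (hE : IsL2Space (P.map Prod.fst) E) (hFE : F ⊆ (E : Set (𝒳 → ℝ)))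
    (hℓ : IsLipschitzConvexLoss F ℓ L)
    (hℓ_meas : ∀ f ∈ F, Measurable fun z : 𝒳 × 𝒴 => ℓ (f z.1) z.2) (hfs : fstar ∈ F)
    (hB : IsBlockPartition B) (hS : 7 * ((Iᶜ).card : ℝ) / 3 ≤ S) (hr : 0 ≤ r) {τ : ℝ} {ω : Ω}
    {u : ℕ → 𝒳 → ℝ} (hu : ∀ n, u n ∈ localClass (P.map Prod.fst) F φ fstar ρ r)
    (hgood : ∀ n, ω ∉ badEvent P ℓ X Y I B fstar τ (u n))
    (hf : f ∈ localClass (P.map Prod.fst) F φ fstar ρ r)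
    (hlim : ∀ x, Tendsto (fun n => u n x) atTop (𝓝 (f x))) :
    MajorityGE (excessRisk P ℓ fstar f - τ)
      (blockMean B ℓ (fun i => X i ω) (fun i => Y i ω) fstar f) := by
  have hrisk := tendsto_excessRisk hE hFE hℓ hℓ_meas hfs hr hu hf hlim
  have hmean := tendsto_blockMean hℓ (fun n => (hu n).1) hf.1 hlim B (fun i => X i ω)
    (fun i => Y i ω) fstar
  -- Failure of the bound is an open condition, so it passes from `f` to some `u n`, simultaneously
  -- for the finitely many blocks.
  obtain ⟨n, hn⟩ : ∃ n, ∀ s, blockMean B ℓ (fun i => X i ω) (fun i => Y i ω) fstar f s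
        < excessRisk P ℓ fstar f - τ →
      blockMean B ℓ (fun i => X i ω) (fun i => Y i ω) fstar (u n) s
        < excessRisk P ℓ fstar (u n) - τ := by
    refine (eventually_all.2 fun s => ?_ : ∀ᶠ n in atTop, _).exists
    rw [eventually_imp_distrib_left]
    exact (hmean s).eventually_lt (hrisk.sub_const τ)
  refine majorityGE_of_card_filter_lt (hB.le_card_informativeBlocks hS)
    (lt_of_le_of_lt ?_ (not_le.1 (hgood n)))
  exact_mod_cast Finset.card_le_card (Finset.monotone_filter_right _ fun s _ hs => (hn s hs).le)

variable [MeasurableSpace Ω] {Pr : Measure Ω} [IsProbabilityMeasure Pr]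

lemma measure_iUnion_badEvent_le (hI : IsInformative Pr P ℓ F fstar X Y I)
    (hE : IsL2Space (P.map Prod.fst) E) (hFE : F ⊆ (E : Set (𝒳 → ℝ)))
    (hℓ : IsLipschitzConvexLoss F ℓ L)
    (hℓ_meas : ∀ f ∈ F, Measurable fun z : 𝒳 × 𝒴 => ℓ (f z.1) z.2) (hfs : fstar ∈ F)
    (hB : IsBlockPartition B) (hN : 0 < N) (hS : 7 * ((Iᶜ).card : ℝ) / 3 ≤ S)
    (hA : 0 < A) (hr : 0 < r) (hlow : 368 * A ^ 2 * L ^ 2 * ((S : ℝ) / N) ≤ r ^ 2)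
    (hcomp : ∀ J ⊆ I, (N : ℝ) / 2 ≤ J.card →
      rademacherComplexity Pr X fstar (localClass (P.map Prod.fst) F φ fstar ρ r) J
        ≤ ENNReal.ofReal ((384 * A * L)⁻¹ * r ^ 2 * J.card))
    {w : ℕ → 𝒳 → ℝ} (hw : ∀ k, w k ∈ localClass (P.map Prod.fst) F φ fstar ρ r) :
    Pr (⋃ k, badEvent P ℓ X Y I B fstar (2 * r ^ 2 / (3 * A)) (w k))
      ≤ ENNReal.ofReal (Real.exp (-(S : ℝ) / 504)) := by
  rw [measure_iUnion_eq_iSup_accumulate]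
  refine iSup_le fun m => (ENNReal.le_ofReal_iff_toReal_le (measure_ne_top _ _)
    (Real.exp_pos _).le).2 ?_
  refine (measureReal_mono fun ω hω => ?_).trans (measureReal_exists_mem_badEvent_le
    (f := fun k : Set.Iic m => w k) hI hE hFE hℓ hℓ_meas hfs hB hN hS hA hr hlow hcomp
    fun k => hw k)
  obtain ⟨k, hk, hωk⟩ := Set.mem_accumulate.1 hω
  exact ⟨⟨k, hk⟩, hωk⟩

lemma exists_measurableSet_compl_of_measure_le {s : Set Ω} {c : ℝ} (hc : 0 ≤ c)
    (h : Pr s ≤ ENNReal.ofReal c) :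
    ∃ t, MeasurableSet t ∧ ENNReal.ofReal (1 - c) ≤ Pr t ∧ Disjoint t s := by
  refine ⟨(toMeasurable Pr s)ᶜ, (measurableSet_toMeasurable Pr s).compl, ?_,
    Set.disjoint_compl_left_iff_subset.2 (subset_toMeasurable Pr s)⟩
  rw [prob_compl_eq_one_sub (measurableSet_toMeasurable Pr s), measure_toMeasurable,
    ENNReal.ofReal_sub _ hc, ENNReal.ofReal_one]
  exact tsub_le_tsub_left h 1

theorem exists_measurableSet_isGoodSample [IsFiniteMeasure P]
    (hI : IsInformative Pr P ℓ F fstar X Y I)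
    (hE : IsL2Space (P.map Prod.fst) E) (hFE : F ⊆ (E : Set (𝒳 → ℝ)))
    (hℓ : IsLipschitzConvexLoss F ℓ L)
    (hℓ_meas : ∀ f ∈ F, Measurable fun z : 𝒳 × 𝒴 => ℓ (f z.1) z.2) (hfs : fstar ∈ F)
    (hB : IsBlockPartition B) (hN : 0 < N) (hS : 7 * ((Iᶜ).card : ℝ) / 3 ≤ S)
    (hA : 0 < A) (hr : 0 < r) (hlow : 368 * A ^ 2 * L ^ 2 * ((S : ℝ) / N) ≤ r ^ 2)
    (hcomp : ∀ J ⊆ I, (N : ℝ) / 2 ≤ J.card →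
      rademacherComplexity Pr X fstar (localClass (P.map Prod.fst) F φ fstar ρ r) J
        ≤ ENNReal.ofReal ((384 * A * L)⁻¹ * r ^ 2 * J.card))
    (hmeas : IsPointwiseMeasurable (localClass (P.map Prod.fst) F φ fstar ρ r)) :
    ∃ Ω₀ : Set Ω, MeasurableSet Ω₀ ∧ ENNReal.ofReal (1 - Real.exp (-(S : ℝ) / 504)) ≤ Pr Ω₀ ∧
      ∀ ω ∈ Ω₀, IsGoodSample P ℓ F φ fstar B ρ r (2 * r ^ 2 / (3 * A)) (fun i => X i ω)
        (fun i => Y i ω) := by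
  obtain ⟨T, hTsub, hTcount, hTdense⟩ := hmeas
  rcases T.eq_empty_or_nonempty with rfl | hTne
  · refine ⟨Set.univ, MeasurableSet.univ, ?_, fun ω _ f hf => ?_⟩
    · rw [measure_univ]
      exact ENNReal.ofReal_le_one.2 (sub_le_self _ (Real.exp_pos _).le)
    · obtain ⟨u, hu, -⟩ := hTdense f hf
      exact absurd (hu 0) (Set.notMem_empty _)
  obtain ⟨w, rfl⟩ := hTcount.exists_eq_range hTne
  obtain ⟨Ω₀, hΩ₀, hprob, hdisj⟩ := exists_measurableSet_compl_of_measure_le (Real.exp_pos _).le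
    (measure_iUnion_badEvent_le hI hE hFE hℓ hℓ_meas hfs hB hN hS hA hr hlow hcomp
      fun k => hTsub (Set.mem_range_self k))
  refine ⟨Ω₀, hΩ₀, hprob, fun ω hω f hf => ?_⟩
  obtain ⟨u, hu, hlim⟩ := hTdense f hf
  refine majorityGE_of_forall_notMem_badEvent hE hFE hℓ hℓ_meas hfs hB hS hr.le
    (fun n => hTsub (hu n)) (fun n hbad => ?_) hf hlim
  obtain ⟨k, hk⟩ := hu n
  exact Set.disjoint_left.1 hdisj hω (Set.mem_iUnion.2 ⟨k, hk ▸ hbad⟩)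

end GoodEvent

lemma pos_and_lt_mul_of_ofReal_div_lt {C a lam : ℝ} (hC : 0 < C) (ha : 0 ≤ a)
    (h : ENNReal.ofReal C / ENNReal.ofReal a < ENNReal.ofReal lam) : 0 < a ∧ C < lam * a := by
  have ha₀ : 0 < a := ha.lt_of_ne' fun h₀ => by
    rw [h₀, ENNReal.ofReal_zero, ENNReal.div_zero (ENNReal.ofReal_pos.2 hC).ne'] at h
    exact not_top_lt h
  rw [← ENNReal.ofReal_div_of_pos ha₀, ENNReal.ofReal_lt_ofReal_iff', div_lt_iff₀ ha₀] at h
  exact ⟨ha₀, h.1⟩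

end MinmaxMOM

end

open MinmaxMOM in
theorem mainTheorem3 {Ω 𝒳 𝒴 : Type*} [MeasurableSpace Ω] [MeasurableSpace 𝒳] [MeasurableSpace 𝒴]
    (Pr : Measure Ω) [IsProbabilityMeasure Pr]
    (P : Measure (𝒳 × 𝒴)) [IsProbabilityMeasure P]
    (E : Submodule ℝ (𝒳 → ℝ)) (hE : MinmaxMOM.IsL2Space (P.map Prod.fst) E)
    (F : Set (𝒳 → ℝ)) (hFE : F ⊆ (E : Set (𝒳 → ℝ))) (hF : Convex ℝ F)
    (ℓ : ℝ → 𝒴 → ℝ) (L : ℝ) (hℓ : MinmaxMOM.IsLipschitzConvexLoss F ℓ L)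
    (hℓ_meas : ∀ f ∈ F, Measurable fun z : 𝒳 × 𝒴 => ℓ (f z.1) z.2)
    (fstar : 𝒳 → ℝ) (hfstar : MinmaxMOM.IsOracle P ℓ F fstar)
    (φ : (𝒳 → ℝ) → ℝ) (η : ℝ) (hφ : MinmaxMOM.IsRegularizer E F φ η)
    (N S : ℕ) (hN : 0 < N)
    (X : Fin N → Ω → 𝒳) (Y : Fin N → Ω → 𝒴) (I : Finset (Fin N))
    (hI : MinmaxMOM.IsInformative Pr P ℓ F fstar X Y I)
    (B : Fin S → Finset (Fin N)) (hB : MinmaxMOM.IsBlockPartition B)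
    (hS : 7 * ((Iᶜ).card : ℝ) / 3 ≤ (S : ℝ))
    (A : ℝ) (hA : 0 < A)
    (C : ℝ≥0∞) (hC : C = MinmaxMOM.CSr Pr (P.map Prod.fst) F φ fstar X I S η L A)
    (hBern : MinmaxMOM.LocalBernstein P ℓ F φ fstar C (MinmaxMOM.rhoStar φ fstar η A) A)
    (hmeas : ∀ r : ℝ, 0 < r → MinmaxMOM.IsPointwiseMeasurable
      (MinmaxMOM.localClass (P.map Prod.fst) F φ fstar (MinmaxMOM.rhoStar φ fstar η A) r)) :
    ∃ Ω₀ : Set Ω, MeasurableSet Ω₀ ∧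
      ENNReal.ofReal (1 - 2 * Real.exp (-(S : ℝ) / 504)) ≤ Pr Ω₀ ∧
      ∀ ω ∈ Ω₀, ∀ lam : ℝ, C / ENNReal.ofReal (φ fstar) < ENNReal.ofReal lam →
        ∀ fhat : 𝒳 → ℝ,
          MinmaxMOM.IsMinmaxMOM B ℓ F φ lam (fun i => X i ω) (fun i => Y i ω) fhat →
            φ (fhat - fstar) ≤ η * (4 + 2 / A) * φ fstar ∧
            eLpNorm (fhat - fstar) 2 (P.map Prod.fst)
              ≤ ENNReal.ofReal ((4 + 6 * A) * lam * φ fstar) / C ^ (1 / 2 : ℝ) := by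
  have hfs := hfstar.1
  by_cases hCtop : C = ∞
  · refine ⟨Set.univ, MeasurableSet.univ, ?_, fun ω _ lam hlam => ?_⟩
    · rw [measure_univ]
      exact ENNReal.ofReal_le_one.2 (sub_le_self _ (by positivity))
    · rw [hCtop, ENNReal.top_div_of_ne_top ENNReal.ofReal_ne_top] at hlam
      exact absurd hlam not_top_lt
  obtain ⟨r, hr, hCr, hlow, hrTilde⟩ :=
    exists_CSr_eq_ofReal_sq hN (hB.pos hN) hA hℓ.pos (hC ▸ hCtop)
  rw [← hC] at hCr
  subst hCr
  obtain ⟨Ω₀, hΩ₀, hprob, hgood⟩ := exists_measurableSet_isGoodSample hI hE hFE hℓ hℓ_meas hfs hB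
    hN hS hA hr hlow (fun J hJ hcard => rademacherComplexity_le_of_rTilde_le hE hFE hF hφ hfs
      hℓ.pos hA hr hrTilde hJ hcard) (hmeas r hr)
  refine ⟨Ω₀, hΩ₀, (ENNReal.ofReal_le_ofReal ?_).trans hprob, fun ω hω lam hlam fhat hmin => ?_⟩
  · linarith [Real.exp_pos (-(S : ℝ) / 504)]
  · obtain ⟨hφs, hlam⟩ :=
      pos_and_lt_mul_of_ofReal_div_lt (by positivity) (hφ.nonneg _ (hFE hfs)) hlam
    exact ⟨(hgood ω hω).regularizer_sub_le hE hFE hF hℓ hfstar hφ hmin hBern hA hr hφs hlam,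
      (hgood ω hω).eLpNorm_sub_le hE hFE hF hℓ hfstar hφ hmin hBern hA hr hφs hlam⟩
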